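/- **Notation.** Fix $d$ and a smooth cut-off $\chi:\mathbb{R}^d\to\mathbb{R}$ with $\chi=1$ on $\{|\xi|\le 1\}$ and $\chi=0$ on $\{|\xi|\ge 2\}$; put $\varphi_0=\chi$ and $\varphi_n(\xi)=\chi(2^{-n}\xi)-\chi(2^{-n+1}\xi)$ for $n\ge1$, and $f_n=\mathcal{F}^{-1}(\varphi_n\hat f)$. Set $$\|f\|_{B^s_{p,q}}=\bigl\|(2^{ns}\|f_n\|_{L^p})_{n\ge0}\bigr\|_{\ell^q},\qquad \|f\|_{F^s_{p,q}}=\bigl\|\,\|(2^{ns}f_n)_{n\ge0}\|_{\ell^q}\bigr\|_{L^p}\quad(p<\infty).$$ For $s>0$ and $1\le p,q\le\infty$, $B^s_{p,q}(\mathbb{R}^d)$ is the space of $f\in L^p(\mathbb{R}^d)$ with $\|f\|_{B^s_{p,q}}<\infty$. For $\alpha>0$, $\mathscr{C}^\alpha_b(\mathbb{R}^d)$ is the set of bounded continuous functions in the closure of the Schwartz space in the norm $\|\cdot\|_{\mathscr{C}^\alpha_b}=\|\cdot\|_{B^\alpha_{\infty,\infty}}$. Further, $\Delta_hf(x)=f(x+h)-f(x)$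 and $\Delta_h^m$ is its $m$-th iterate. **Lemma (fractional integration by parts).** Let $m\ge1$ be an integer and let $\alpha,s$ be real numbers with $0<\alpha<s<m$. 1. There is a constant $C>0$, depending only on $d,m,s,\alpha$ and $\chi$, such that the following holds. Let $X$ be an $\mathbb{R}^d$-valued random variable and $K>0$, and suppose that for every $\phi\in\mathscr{C}^\alpha_b(\mathbb{R}^d)$ and every $h\in\mathbb{R}^d$ with $|h|\le1$, $$\mathbb{E}[\Delta_h^m\phi(X)]\le K|h|^s\|\phi\|_{\mathscr{C}^\alpha_b}.$$ Then $X$ has a density $f_X$ with respect to the Lebesgue measure on $\mathbb{R}^d$, $f_X\in B^{s-\alpha}_{1,\infty}(\mathbb{R}^d)$, and $\|f_X\|_{B^{s-\alpha}_{1,\infty}}\le C(1+K)$. 2. Let $1<p<\infty$ and let $q$ be the Hölder conjugate exponent of $p$. There is a constant $C>0$, depending only on $d,m,s,\alpha,p$ and $\chi$, such that the following holds. Let $f\in L^p(\mathbb{R}^d)$ and $K>0$, and suppose that for every $\phi\in C^\infty_c(\mathbb{R}^d)$ and every $h\in\mathbb{R}^d$ with $|h|\le1$, $$\Bigl|\int_{\mathbb{R}^d}\Delta_h^m\phi(x)\,f(x)\,dx\Bigr|\le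 K|h|^s\|\phi\|_{F^\alpha_{q,\infty}}.$$ Then $f\in B^{s-\alpha}_{p,\infty}(\mathbb{R}^d)$ and $\|f\|_{B^{s-\alpha}_{p,\infty}}\le C(\|f\|_{L^p}+K)$. -/

import Mathlib

open MeasureTheory ProbabilityTheory
open scoped ENNReal BoundedContinuousFunction SchwartzMap FourierTransform Convolution

noncomputable section

namespace Smoothing

/-- The Euclidean space `ℝ^d`. -/
abbrev E (d : ℕ) : Type := EuclideanSpace ℝ (Fin d)

/-- A smooth cut-off `χ` with `χ = 1` on the unit ball and `χ = 0` outside the ball of radius `2`.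
It generates the band-limited (dyadic) decomposition `symbol`. -/
structure Cutoff (d : ℕ) where
  toFun : E d → ℝ
  smooth : ContDiff ℝ (⊤ : ℕ∞) toFun
  eq_one : ∀ ξ, ‖ξ‖ ≤ 1 → toFun ξ = 1
  eq_zero : ∀ ξ, 2 ≤ ‖ξ‖ → toFun ξ = 0

instance (d : ℕ) : Nonempty (Cutoff d) := by
  let b : ContDiffBump (0 : E d) := ⟨1, 2, by norm_num, by norm_num⟩
  refine ⟨⟨b, b.contDiff, fun ξ h => ?_, fun ξ h => ?_⟩⟩
  · exact b.one_of_mem_closedBall (by simpa [b] using h)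
  · exact b.zero_of_le_dist (by simpa [b] using h)

variable {d : ℕ}

/-- The dyadic partition of unity on the frequency space: `φ₀ = χ` and
`φₙ(ξ) = χ(2⁻ⁿ ξ) - χ(2⁻⁽ⁿ⁻¹⁾ ξ)` for `n ≥ 1`. -/
def Cutoff.symbol (χ : Cutoff d) : ℕ → E d → ℝ
  | 0, ξ => χ.toFun ξ
  | n + 1, ξ => χ.toFun (((2 : ℝ) ^ (n + 1))⁻¹ • ξ) - χ.toFun (((2 : ℝ) ^ n)⁻¹ • ξ)

/-- The partial sums of the symbols are `χ(2⁻ⁿ ξ)`. -/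
theorem Cutoff.sum_symbol (χ : Cutoff d) (n : ℕ) (ξ : E d) :
    ∑ k ∈ Finset.range (n + 1), χ.symbol k ξ = χ.toFun (((2 : ℝ) ^ n)⁻¹ • ξ) := by
  induction n with
  | zero => simp [Cutoff.symbol]
  | succ n ih => rw [Finset.sum_range_succ, ih]; simp [Cutoff.symbol]

/-- The Schwartz function `𝓕⁻¹ φₙ`. -/
def Cutoff.kernel (χ : Cutoff d) (n : ℕ) : E d → ℂ :=
  𝓕⁻ (fun ξ : E d => (χ.symbol n ξ : ℂ))

/-- The Littlewood–Paley block `fₙ = 𝓕⁻¹ (φₙ 𝓕 f) = f ⋆ 𝓕⁻¹ φₙ` of a function `f`, which is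
meaningful for `f` in any `L^p`, `1 ≤ p ≤ ∞` (the only functions it is used for). -/
def Cutoff.block (χ : Cutoff d) (n : ℕ) (f : E d → ℝ) : E d → ℂ :=
  f ⋆[ContinuousLinearMap.lsmul ℝ ℝ, volume] χ.kernel n

/-- The Besov norm `‖ (2^{ns} ‖fₙ‖_{L^p})ₙ ‖_{ℓ^q}`. -/
def besovNorm (χ : Cutoff d) (s : ℝ) (p q : ℝ≥0∞) (f : E d → ℝ) : ℝ≥0∞ :=
  eLpNorm (fun n : ℕ => (2 : ℝ≥0∞) ^ ((n : ℝ) * s) * eLpNorm (χ.block n f) p volume) q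
    Measure.count

/-- The Triebel–Lizorkin norm `‖ ‖(2^{ns} fₙ(x))ₙ‖_{ℓ^q} ‖_{L^p(dx)}` (for `p < ∞`). -/
def triebelLizorkinNorm (χ : Cutoff d) (s : ℝ) (p q : ℝ≥0∞) (f : E d → ℝ) : ℝ≥0∞ :=
  eLpNorm (fun x : E d =>
    eLpNorm (fun n : ℕ => (2 : ℝ≥0∞) ^ ((n : ℝ) * s) * ‖χ.block n f x‖ₑ) q Measure.count)
    p volume

/-- Membership in the Besov space `B^s_{p,q}(ℝ^d)` for `s > 0` (where `B^s_{p,q} ⊆ L^p`). -/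
def MemBesov (χ : Cutoff d) (s : ℝ) (p q : ℝ≥0∞) (f : E d → ℝ) : Prop :=
  MemLp f p volume ∧ besovNorm χ s p q f < ∞

/-- The norm of the Zygmund space `𝒞^α_b = B^α_{∞,∞}`. -/
def zygmundNorm (χ : Cutoff d) (α : ℝ) (φ : E d → ℝ) : ℝ≥0∞ :=
  besovNorm χ α ∞ ∞ φ

/-- The separable Zygmund space `𝒞^α_b(ℝ^d)`, `α > 0`: the closure of the Schwartz space in the
norm of `B^α_{∞,∞}`. Its elements are bounded continuous functions since `α > 0`. -/
def zygmundSpace (χ : Cutoff d) (α : ℝ) : Set (E d →ᵇ ℝ) :=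
  {φ | ∀ ε : ℝ≥0∞, 0 < ε → ∃ g : 𝓢(E d, ℝ), zygmundNorm χ α (fun x => φ x - g x) < ε}

end Smoothing

end

/-! The norm of a Littlewood–Paley block is computed by duality. Pairing `fₙ` with a test function
`g` amounts to pairing `f`, or the law of `X`, with the adjoint block of `g`, whose frequencies lie
in an annulus of size `2ⁿ`. On the unit annulus a smooth symbol can be written as `∑ⱼ (e^{2πi⟨hⱼ,ξ⟩}
- 1)^m Mⱼ(ξ)` with smooth compactly supported `Mⱼ` and short coordinate steps `hⱼ`
(`exists_factorization_of_annulus`). After dilation the adjoint block of `g` is a sum of differences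
`Δ^m` with steps `2⁻ⁿhⱼ` of functions `uⱼ` with frequencies below `2ⁿ⁺¹`. The hypothesis bounds each
pairing by a multiple of `K 2^{-ns}` times the norm of `uⱼ`. Band-limitation bounds that norm by a
multiple of `2^{nα} ‖uⱼ‖_{L^r}`, and Young's inequality bounds the latter by a multiple of `2^{nα}
‖g‖_{L^r}`. The product `K 2^{-n(s-α)} ‖g‖_{L^r}` is the Besov decay; this is
`exists_enorm_fourierMultiplierCLM_le`. The block `n = 0` has no annulus and is bounded by Young's
inequality alone.

Both parts share this estimate because the norms of `F^α_{q,∞}` and of `B^α_{∞,∞}` are dominated by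
that of `B^α_{r,1}`, with `r = q` and `r = ∞` respectively. For functions in `L^p` the hypothesis
concerns compactly supported test functions only; it extends to Schwartz functions by truncation,
since the norm of `B^α_{q,1}` is continuous on the Schwartz space.

For a law `μ` the density is not known in advance, so the blocks `μₙ = μ ⋆ 𝓕⁻¹φₙ` are estimated
first. Since `s > α`, the series `∑ ‖μₙ‖_{L¹}` converges. The partial sums of `μₙ` are convolutions
of `μ` with an approximate identity, hence `μ` is dominated by `(∑ |μₙ|) dx` and is absolutely
continuous (`Cutoff.absolutelyContinuous_of_tsum_ne_top`). The blocks of its density are then the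
`μₙ`. -/

noncomputable section

namespace Smoothing

variable {d : ℕ}

/-! ### Young's inequality for `L^r * L^1` -/

/-- **Young's inequality**: a function dominated by a convolution with a kernel `k` of finite mass
has `L^r` norm at most the mass of `k` times that of the other factor. -/
theorem eLpNorm_le_of_enorm_le_lconvolution {F G : Type*} [NormedAddCommGroup F]
    [NormedAddCommGroup G] {f : E d → F} (hf : AEStronglyMeasurable f volume)
    {k : E d → ℝ≥0∞} (hk : Measurable k) {g : E d → G} {r : ℝ≥0∞} (hr : 1 ≤ r)
    (hg : ∀ x, ‖g x‖ₑ ≤ ∫⁻ t, ‖f t‖ₑ * k (x - t)) :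
    eLpNorm g r volume ≤ (∫⁻ x, k x) * eLpNorm f r volume := by
  have hkx : ∀ x, ∫⁻ t, k (x - t) = ∫⁻ t, k t := fun x => lintegral_sub_left_eq_self k x
  rcases eq_or_ne r ∞ with rfl | hr'
  · rw [eLpNorm_exponent_top, eLpNorm_exponent_top]
    refine essSup_le_of_ae_le _ (Filter.Eventually.of_forall fun x => (hg x).trans ?_)
    have h1 : ∀ᵐ t ∂(volume : Measure (E d)), ‖f t‖ₑ * k (x - t) ≤
        eLpNormEssSup f volume * k (x - t) := by
      filter_upwards [enorm_ae_le_eLpNormEssSup f volume] with t ht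
      gcongr
    refine (lintegral_mono_ae h1).trans ?_
    rw [lintegral_const_mul _ (by fun_prop), hkx, mul_comm]
  set p := r.toReal with hp
  have hr0 : r ≠ 0 := (zero_lt_one.trans_le hr).ne'
  have hp1 : 1 ≤ p := by
    rw [hp, ← ENNReal.toReal_one]
    exact ENNReal.toReal_mono hr' hr
  have hp0 : 0 < p := by linarith
  have hfm : AEMeasurable (fun t => ‖f t‖ₑ) volume := hf.enorm
  -- Hölder's inequality for the splitting `k = k^{1/p} k^{1/q}`; for `p = 1` this is the hypothesis
  -- itself.
  have key : ∀ x, ‖g x‖ₑ ^ p ≤ (∫⁻ t, ‖f t‖ₑ ^ p * k (x - t)) * (∫⁻ t, k t) ^ (p - 1) := by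
    intro x
    have hkm : Measurable fun t => k (x - t) := by fun_prop
    rcases hp1.eq_or_lt with h1 | h1
    · simpa [← h1] using hg x
    have hpq := Real.HolderConjugate.conjExponent h1
    set q := p.conjExponent with hq
    have hol := ENNReal.lintegral_mul_le_Lp_mul_Lq volume hpq
      (f := fun t => ‖f t‖ₑ * k (x - t) ^ (1 / p)) (g := fun t => k (x - t) ^ (1 / q))
      (hfm.mul (hkm.pow_const _).aemeasurable) (hkm.pow_const _).aemeasurable
    have e1 : ∀ t, ((fun t => ‖f t‖ₑ * k (x - t) ^ (1 / p)) * fun t => k (x - t) ^ (1 / q)) t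
        = ‖f t‖ₑ * k (x - t) := by
      intro t
      simp only [Pi.mul_apply]
      rw [mul_assoc, ← ENNReal.rpow_add_of_nonneg _ _ (by positivity)
        (one_div_nonneg.2 hpq.symm.nonneg)]
      have : 1 / p + 1 / q = 1 := by simpa using hpq.inv_add_inv_eq_one
      rw [this, ENNReal.rpow_one]
    have e2 : ∀ t, (‖f t‖ₑ * k (x - t) ^ (1 / p)) ^ p = ‖f t‖ₑ ^ p * k (x - t) := by
      intro t
      rw [ENNReal.mul_rpow_of_nonneg _ _ hp0.le, ← ENNReal.rpow_mul,
        one_div_mul_cancel hp0.ne', ENNReal.rpow_one]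
    have e3 : ∀ t, (k (x - t) ^ (1 / q)) ^ q = k (x - t) := by
      intro t
      rw [← ENNReal.rpow_mul, one_div_mul_cancel hpq.symm.ne_zero, ENNReal.rpow_one]
    simp only [e1, e2, e3, hkx] at hol
    calc ‖g x‖ₑ ^ p ≤ ((∫⁻ t, ‖f t‖ₑ ^ p * k (x - t)) ^ (1 / p) *
          (∫⁻ t, k t) ^ (1 / q)) ^ p := by
          gcongr
          exact (hg x).trans hol
      _ = _ := by
          rw [ENNReal.mul_rpow_of_nonneg _ _ hp0.le, ← ENNReal.rpow_mul,
            one_div_mul_cancel hp0.ne', ENNReal.rpow_one, ← ENNReal.rpow_mul]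
          congr 2
          have := hpq.sub_one_mul_conj
          have hq0 := hpq.symm.ne_zero
          field_simp
          linarith
  rw [eLpNorm_eq_lintegral_rpow_enorm_toReal hr0 hr',
    eLpNorm_eq_lintegral_rpow_enorm_toReal hr0 hr', ← hp]
  have hswap : ∫⁻ x, ∫⁻ t, ‖f t‖ₑ ^ p * k (x - t) = (∫⁻ x, k x) * ∫⁻ t, ‖f t‖ₑ ^ p := by
    rw [lintegral_lintegral_swap]
    · have : ∀ t, ∫⁻ x, ‖f t‖ₑ ^ p * k (x - t) = ‖f t‖ₑ ^ p * ∫⁻ x, k x := by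
        intro t
        rw [lintegral_const_mul _ (by fun_prop), lintegral_sub_right_eq_self k t]
      simp only [this]
      rw [lintegral_mul_const'' _ (hfm.pow_const _), mul_comm]
    · refine AEMeasurable.mul ?_ ?_
      · exact (hfm.pow_const p).comp_snd
      · exact (hk.comp (measurable_fst.sub measurable_snd)).aemeasurable
  calc (∫⁻ x, ‖g x‖ₑ ^ p) ^ (1 / p)
      ≤ (∫⁻ x, (∫⁻ t, ‖f t‖ₑ ^ p * k (x - t)) * (∫⁻ t, k t) ^ (p - 1)) ^ (1 / p) := by
        gcongr with x
        exact key x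
    _ ≤ ((∫⁻ x, ∫⁻ t, ‖f t‖ₑ ^ p * k (x - t)) * (∫⁻ t, k t) ^ (p - 1)) ^ (1 / p) := by
        gcongr
        -- A finite constant leaves the integral without any measurability. If it is infinite,
        -- either the right side is `∞`, or `f = 0` almost everywhere and the left side vanishes.
        rcases eq_or_ne ((∫⁻ t, k t) ^ (p - 1)) ∞ with h | h
        · rw [h]
          rcases eq_or_ne (∫⁻ x, ∫⁻ t, ‖f t‖ₑ ^ p * k (x - t)) 0 with h0 | h0
          · have hk0 : ∫⁻ t, k t ≠ 0 := by
              intro h'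
              rw [h'] at h
              rcases hp1.eq_or_lt with h1 | h1
              · simp [← h1] at h
              · simp [ENNReal.zero_rpow_of_pos (sub_pos.2 h1)] at h
            rw [hswap, mul_eq_zero, or_iff_right hk0, lintegral_eq_zero_iff' (hfm.pow_const _)] at h0
            have : ∀ x, ∫⁻ t, ‖f t‖ₑ ^ p * k (x - t) = 0 := by
              intro x
              rw [← lintegral_zero]
              refine lintegral_congr_ae ?_
              filter_upwards [h0] with t ht
              simp only [Pi.zero_apply] at ht
              simp [ht]
            simp [this]
          · rw [ENNReal.mul_top h0]; exact le_top
        · exact (lintegral_mul_const' _ _ h).le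
    _ = (∫⁻ x, k x) * (∫⁻ x, ‖f x‖ₑ ^ p) ^ (1 / p) := by
        rw [hswap, mul_right_comm, ENNReal.mul_rpow_of_nonneg _ _ (by positivity)]
        congr 1
        have : (∫⁻ t, k t) * (∫⁻ t, k t) ^ (p - 1) = (∫⁻ t, k t) ^ p := by
          nth_rw 1 [← ENNReal.rpow_one (∫⁻ t, k t)]
          rw [← ENNReal.rpow_add_of_nonneg _ _ zero_le_one (by linarith)]
          congr 1
          ring
        rw [this, ← ENNReal.rpow_mul, mul_one_div_cancel hp0.ne', ENNReal.rpow_one]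

/-! ### Scaling of the inverse Fourier transform -/

theorem fourierInv_comp_smul (a : E d → ℂ) {c : ℝ} (hc : 0 < c) (x : E d) :
    𝓕⁻ (fun ξ => a (c • ξ)) x = ((c ^ d)⁻¹ : ℝ) • 𝓕⁻ a (c⁻¹ • x) := by
  rw [Real.fourierInv_eq, Real.fourierInv_eq]
  have := Measure.integral_comp_smul (volume : Measure (E d))
    (fun v => Real.fourierChar (inner ℝ v (c⁻¹ • x)) • a v) c
  simp only [finrank_euclideanSpace, Fintype.card_fin] at this
  rw [abs_of_pos (by positivity)] at this
  rw [← this]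
  congr 1
  ext v
  rw [inner_smul_left, inner_smul_right]
  simp [hc.ne']

theorem lintegral_comp_smul (g : E d → ℝ≥0∞) {c : ℝ} (hc : 0 < c) :
    ∫⁻ x, g (c • x) = ENNReal.ofReal ((c ^ d)⁻¹) * ∫⁻ x, g x := by
  have h := Measure.map_addHaar_smul (volume : Measure (E d)) hc.ne'
  have h2 : ∫⁻ x, g x ∂(Measure.map (c • ·) (volume : Measure (E d))) = ∫⁻ x, g (c • x) :=
    (MeasurableEquiv.smul₀ c hc.ne').measurableEmbedding.lintegral_map g
  rw [← h2, h, lintegral_smul_measure]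
  simp [abs_of_pos hc]

/-- The amplitude factor and the Jacobian cancel. This is why the constants for dyadic multipliers
do not depend on the scale. -/
theorem lintegral_enorm_fourierInv_comp_smul (a : E d → ℂ) {c : ℝ} (hc : 0 < c) :
    ∫⁻ x, ‖𝓕⁻ (fun ξ => a (c • ξ)) x‖ₑ = ∫⁻ x, ‖𝓕⁻ a x‖ₑ := by
  simp_rw [fourierInv_comp_smul a hc, enorm_smul]
  rw [lintegral_const_mul' _ _ enorm_ne_top,
    lintegral_comp_smul (fun x => ‖𝓕⁻ a x‖ₑ) (inv_pos.2 hc), ← mul_assoc]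
  rw [Real.enorm_eq_ofReal (by positivity), ← ENNReal.ofReal_mul (by positivity)]
  have : (c ^ d)⁻¹ * (c⁻¹ ^ d)⁻¹ = 1 := by
    rw [inv_pow, inv_inv, inv_mul_cancel₀ (pow_pos hc d).ne']
  rw [this]; simp

/-! ### Compactly supported Fourier multipliers -/

theorem hasTemperateGrowth_of_hasCompactSupport {a : E d → ℂ} (ha : ContDiff ℝ (⊤ : ℕ∞) a)
    (hc : HasCompactSupport a) : a.HasTemperateGrowth :=
  (hc.toSchwartzMap ha).hasTemperateGrowth

theorem fourierInv_toSchwartzMap {a : E d → ℂ} (ha : ContDiff ℝ (⊤ : ℕ∞) a)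
    (hc : HasCompactSupport a) : ⇑(𝓕⁻ (hc.toSchwartzMap ha) : 𝓢(E d, ℂ)) = 𝓕⁻ a := by
  rw [SchwartzMap.fourierInv_coe]; rfl

theorem fourierMultiplierCLM_eq_convolution {a : E d → ℂ} (ha : ContDiff ℝ (⊤ : ℕ∞) a)
    (hc : HasCompactSupport a) (φ : 𝓢(E d, ℂ)) (x : E d) :
    SchwartzMap.fourierMultiplierCLM ℂ a φ x = ∫ t, φ t * 𝓕⁻ a (x - t) := by
  have h1 : SchwartzMap.fourierMultiplierCLM ℂ a φ =
      SchwartzMap.convolution (ContinuousLinearMap.mul ℂ ℂ) φ (𝓕⁻ (hc.toSchwartzMap ha)) := by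
    rw [SchwartzMap.fourierMultiplierCLM_apply, SchwartzMap.convolution]
    simp only [LinearMap.coe_mk, AddHom.coe_mk, ContinuousLinearMap.coe_comp, Function.comp_apply,
      FourierTransform.fourierCLM_apply, FourierTransform.fourierInvCLM_apply,
      FourierTransform.fourier_fourierInv_eq]
    congr 1
    ext ξ
    rw [SchwartzMap.smulLeftCLM_apply_apply (hasTemperateGrowth_of_hasCompactSupport ha hc),
      SchwartzMap.pairing_apply_apply]
    simp [mul_comm]
  rw [h1, SchwartzMap.convolution_apply, fourierInv_toSchwartzMap]
  rfl

theorem measurable_enorm_fourierInv {a : E d → ℂ} (ha : ContDiff ℝ (⊤ : ℕ∞) a)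
    (hc : HasCompactSupport a) : Measurable fun x => ‖𝓕⁻ a x‖ₑ := by
  rw [← fourierInv_toSchwartzMap ha hc]
  exact (𝓕⁻ (hc.toSchwartzMap ha) : 𝓢(E d, ℂ)).continuous.measurable.enorm

theorem integrable_fourierInv {a : E d → ℂ} (ha : ContDiff ℝ (⊤ : ℕ∞) a)
    (hc : HasCompactSupport a) : Integrable (𝓕⁻ a) := by
  rw [← fourierInv_toSchwartzMap ha hc]
  exact (𝓕⁻ (hc.toSchwartzMap ha) : 𝓢(E d, ℂ)).integrable

theorem continuous_fourierInv {a : E d → ℂ} (ha : ContDiff ℝ (⊤ : ℕ∞) a)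
    (hc : HasCompactSupport a) : Continuous (𝓕⁻ a) := by
  rw [← fourierInv_toSchwartzMap ha hc]
  exact (𝓕⁻ (hc.toSchwartzMap ha) : 𝓢(E d, ℂ)).continuous

theorem lintegral_enorm_fourierInv_lt_top {a : E d → ℂ} (ha : ContDiff ℝ (⊤ : ℕ∞) a)
    (hc : HasCompactSupport a) : ∫⁻ x, ‖𝓕⁻ a x‖ₑ < ∞ :=
  (integrable_fourierInv ha hc).2

theorem eLpNorm_fourierMultiplierCLM_le {a : E d → ℂ} (ha : ContDiff ℝ (⊤ : ℕ∞) a)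
    (hc : HasCompactSupport a) (φ : 𝓢(E d, ℂ)) {r : ℝ≥0∞} (hr : 1 ≤ r) :
    eLpNorm (SchwartzMap.fourierMultiplierCLM ℂ a φ) r volume ≤
      (∫⁻ x, ‖𝓕⁻ a x‖ₑ) * eLpNorm φ r volume := by
  refine eLpNorm_le_of_enorm_le_lconvolution φ.continuous.aestronglyMeasurable
    (measurable_enorm_fourierInv ha hc) hr fun x => ?_
  rw [fourierMultiplierCLM_eq_convolution ha hc]
  refine (enorm_integral_le_lintegral_enorm _).trans_eq ?_
  simp [enorm_mul]

theorem contDiff_comp_const_smul {F : Type*} [NormedAddCommGroup F] [NormedSpace ℝ F]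
    {a : E d → F} (ha : ContDiff ℝ (⊤ : ℕ∞) a) (c : ℝ) :
    ContDiff ℝ (⊤ : ℕ∞) fun ξ => a (c • ξ) := ha.comp (contDiff_const_smul c)

theorem hasCompactSupport_comp_const_smul {F : Type*} [NormedAddCommGroup F]
    {a : E d → F} (hc : HasCompactSupport a) {c : ℝ} (h : c ≠ 0) :
    HasCompactSupport fun ξ => a (c • ξ) :=
  hc.comp_homeomorph (Homeomorph.smulOfNeZero c h)

/-! ### Translations and iterated differences of Schwartz functions -/

/-- The symbol `e^{2πi⟨h, ξ⟩}` of the translation by `h`. -/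
def translationSymbol (h ξ : E d) : ℂ := Complex.exp (((2 * Real.pi * inner ℝ h ξ : ℝ) : ℂ) * Complex.I)

theorem translationSymbol_smul (c : ℝ) (h ξ : E d) :
    translationSymbol (c • h) ξ = translationSymbol h (c • ξ) := by
  simp [translationSymbol, inner_smul_left, inner_smul_right]

theorem contDiff_translationSymbol (h : E d) : ContDiff ℝ (⊤ : ℕ∞) (translationSymbol h) := by
  have h1 : ContDiff ℝ (⊤ : ℕ∞) fun ξ : E d => (2 * Real.pi * inner ℝ h ξ : ℝ) :=
    contDiff_const.mul (contDiff_const.inner ℝ contDiff_id)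
  have h2 : ContDiff ℝ (⊤ : ℕ∞) fun ξ : E d => (((2 * Real.pi * inner ℝ h ξ : ℝ) : ℂ)) :=
    Complex.ofRealCLM.contDiff.comp h1
  exact (h2.mul contDiff_const).cexp

/-- The difference `Δ_h φ` of a Schwartz function. -/
def schwartzDiff {F : Type*} [NormedAddCommGroup F] [NormedSpace ℝ F] (h : E d) :
    𝓢(E d, F) →L[ℝ] 𝓢(E d, F) :=
  SchwartzMap.compSubConstCLM ℝ (-h) - ContinuousLinearMap.id ℝ _

theorem schwartzDiff_apply {F : Type*} [NormedAddCommGroup F] [NormedSpace ℝ F] (h : E d)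
    (φ : 𝓢(E d, F)) (x : E d) : schwartzDiff h φ x = φ (x + h) - φ x := by
  simp [schwartzDiff]

theorem coe_schwartzDiff_iterate {F : Type*} [NormedAddCommGroup F] [NormedSpace ℝ F] (h : E d)
    (φ : 𝓢(E d, F)) (m : ℕ) : ⇑((schwartzDiff h)^[m] φ) = (fwdDiff h)^[m] φ := by
  induction m with
  | zero => rfl
  | succ m ih =>
    rw [Function.iterate_succ_apply', Function.iterate_succ_apply', ← ih]
    ext x
    rw [schwartzDiff_apply, fwdDiff]

theorem fourier_schwartzDiff (h : E d) (φ : 𝓢(E d, ℂ)) (ξ : E d) :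
    𝓕 (schwartzDiff h φ) ξ = (translationSymbol h ξ - 1) * 𝓕 φ ξ := by
  have h1 : 𝓕 (schwartzDiff h φ) = 𝓕 (SchwartzMap.compSubConstCLM ℝ (-h) φ) - 𝓕 φ := by
    have := map_sub (FourierTransform.fourierCLM ℝ 𝓢(E d, ℂ)) (SchwartzMap.compSubConstCLM ℝ (-h) φ) φ
    simpa [schwartzDiff] using this
  have h2 : 𝓕 (SchwartzMap.compSubConstCLM ℝ (-h) φ) ξ = translationSymbol h ξ * 𝓕 φ ξ := by
    rw [SchwartzMap.fourier_coe, SchwartzMap.fourier_coe, Real.fourier_eq, Real.fourier_eq]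
    have := integral_sub_right_eq_self (μ := (volume : Measure (E d)))
      (fun v => Real.fourierChar (-inner ℝ (v - h) ξ) • φ v) (-h)
    simp only [sub_neg_eq_add, add_sub_cancel_right] at this
    simp only [SchwartzMap.compSubConstCLM_apply, sub_neg_eq_add]
    rw [this, ← integral_const_mul]
    congr 1
    ext v
    rw [inner_sub_left, neg_sub, sub_eq_add_neg, AddChar.map_add_eq_mul, mul_smul,
      Circle.smul_def, smul_eq_mul, translationSymbol, Real.fourierChar_apply]
  rw [h1, sub_apply, h2]
  ring

theorem fourier_schwartzDiff_iterate (h : E d) (φ : 𝓢(E d, ℂ)) (m : ℕ) (ξ : E d) :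
    𝓕 ((schwartzDiff h)^[m] φ) ξ = (translationSymbol h ξ - 1) ^ m * 𝓕 φ ξ := by
  induction m with
  | zero => simp
  | succ m ih => rw [Function.iterate_succ_apply', fourier_schwartzDiff, ih]; ring

/-! ### Factorization of annular symbols through differences -/

theorem translationSymbol_neg (h ξ : E d) :
    translationSymbol (-h) ξ = (starRingEnd ℂ) (translationSymbol h ξ) := by
  rw [translationSymbol, translationSymbol, ← Complex.exp_conj]
  congr 1
  simp [inner_neg_left, Complex.conj_ofNat]

theorem eq_zero_of_translationSymbol_eq_one {h ξ : E d} (hlt : |inner ℝ h ξ| < 1)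
    (h1 : translationSymbol h ξ = 1) : inner ℝ h ξ = 0 := by
  rw [translationSymbol, Complex.exp_eq_one_iff] at h1
  obtain ⟨n, hn⟩ := h1
  have hn' : inner ℝ h ξ = (n : ℝ) := by
    have hI : (2 * (Real.pi : ℂ) * Complex.I) ≠ 0 := Complex.two_pi_I_ne_zero
    have : ((inner ℝ h ξ : ℝ) : ℂ) * (2 * (Real.pi : ℂ) * Complex.I)
        = (n : ℂ) * (2 * (Real.pi : ℂ) * Complex.I) := by
      rw [← hn]; push_cast; ring
    exact_mod_cast mul_right_cancel₀ hI this
  rw [hn'] at hlt ⊢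
  have : |n| < 1 := by exact_mod_cast hlt
  have : n = 0 := by simpa using this
  simp [this]

/-- The step in the direction of the `j`-th coordinate. -/
def coordStep (j : Fin d) : E d := EuclideanSpace.single j (1 / 8 : ℝ)

theorem inner_coordStep (j : Fin d) (ξ : E d) : inner ℝ (coordStep j) ξ = ξ j / 8 := by
  simp [coordStep, EuclideanSpace.inner_single_left]
  ring

theorem norm_coordStep (j : Fin d) : ‖coordStep j‖ = 1 / 8 := by
  simp [coordStep]

/-- `∑ₖ |e^{2πi⟨hₖ, ξ⟩} - 1|^{2m}` over the coordinate steps `hₖ`. -/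
def diffSquareSum (d m : ℕ) (ξ : E d) : ℂ :=
  ∑ k : Fin d, ((translationSymbol (coordStep k) ξ - 1) *
    (translationSymbol (-coordStep k) ξ - 1)) ^ m

theorem contDiff_diffSquareSum (m : ℕ) : ContDiff ℝ (⊤ : ℕ∞) (diffSquareSum d m) := by
  refine ContDiff.sum fun k _ => ContDiff.pow (ContDiff.mul ?_ ?_) m
  · exact (contDiff_translationSymbol _).sub contDiff_const
  · exact (contDiff_translationSymbol _).sub contDiff_const

/-- Each summand is a power of `|e^{2πi⟨hₖ,ξ⟩} - 1|²`, so the sum vanishes only if every phase is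
trivial. With steps of length `1/8`, the phases `ξₖ/8` stay below one full period for `‖ξ‖ < 8`,
which forces `ξ = 0`. -/
theorem diffSquareSum_ne_zero (m : ℕ) {ξ : E d} (h0 : ξ ≠ 0) (h8 : ‖ξ‖ < 8) :
    diffSquareSum d m ξ ≠ 0 := by
  have hterm : ∀ k : Fin d, ((translationSymbol (coordStep k) ξ - 1) *
      (translationSymbol (-coordStep k) ξ - 1)) ^ m =
      (((Complex.normSq (translationSymbol (coordStep k) ξ - 1)) ^ m : ℝ) : ℂ) := by
    intro k
    rw [translationSymbol_neg, ← map_one (starRingEnd ℂ), ← map_sub, map_one, Complex.mul_conj]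
    push_cast; rfl
  intro h
  rw [diffSquareSum, Finset.sum_congr rfl fun k _ => hterm k, ← Complex.ofReal_sum,
    Complex.ofReal_eq_zero, Finset.sum_eq_zero_iff_of_nonneg fun k _ =>
      pow_nonneg (Complex.normSq_nonneg _) m] at h
  refine h0 (PiLp.ext fun k => ?_)
  have h1 := eq_zero_of_pow_eq_zero (h k (Finset.mem_univ k))
  rw [Complex.normSq_eq_zero, sub_eq_zero] at h1
  have h2 := eq_zero_of_translationSymbol_eq_one (by
    rw [inner_coordStep, abs_div, div_lt_one (by norm_num)]
    have := (PiLp.norm_apply_le ξ k).trans_lt h8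
    rw [Real.norm_eq_abs] at this
    rw [abs_of_pos (show (0 : ℝ) < 8 by norm_num)]
    exact this) h1
  rw [inner_coordStep] at h2
  simpa using h2

/-- The numerator is locally zero off the closed annulus `1/2 ≤ ‖ξ‖ ≤ 2`, so the zeros of `D` at the
origin and far away do no harm. -/
theorem contDiff_div_of_annulus {θ D b : E d → ℂ} (hθ : ContDiff ℝ (⊤ : ℕ∞) θ)
    (h0 : ∀ ξ, ‖ξ‖ ≤ 1 / 2 → θ ξ = 0) (h2 : ∀ ξ, 2 ≤ ‖ξ‖ → θ ξ = 0)
    (hb : ContDiff ℝ (⊤ : ℕ∞) b)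
    (hD : ContDiff ℝ (⊤ : ℕ∞) D) (hD0 : ∀ ξ, ξ ≠ 0 → ‖ξ‖ < 8 → D ξ ≠ 0) :
    ContDiff ℝ (⊤ : ℕ∞) fun ξ => θ ξ * b ξ / D ξ := by
  rw [contDiff_iff_contDiffAt]
  intro ξ
  by_cases hξ : ‖ξ‖ < 1 / 2
  · refine (contDiffAt_const (c := (0 : ℂ))).congr_of_eventuallyEq ?_
    filter_upwards [continuous_norm.continuousAt.eventually (gt_mem_nhds hξ)] with y hy
    simp [h0 y hy.le]
  by_cases hξ2 : 2 < ‖ξ‖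
  · refine (contDiffAt_const (c := (0 : ℂ))).congr_of_eventuallyEq ?_
    filter_upwards [continuous_norm.continuousAt.eventually (lt_mem_nhds hξ2)] with y hy
    simp [h2 y hy.le]
  simp only [div_eq_mul_inv]
  refine (hθ.mul hb).contDiffAt.mul (hD.contDiffAt.inv (hD0 ξ ?_ ?_))
  · rintro rfl
    simp at hξ
  · linarith

theorem hasCompactSupport_of_eq_zero {F : Type*} [Zero F] {a : E d → F} {R : ℝ}
    (h : ∀ ξ, R ≤ ‖ξ‖ → a ξ = 0) : HasCompactSupport a :=
  HasCompactSupport.intro (isCompact_closedBall 0 R) fun ξ hξ => h ξ (by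
    simp only [Metric.mem_closedBall, dist_zero_right, not_le] at hξ
    exact hξ.le)

/-- One multiplies and divides by `∑ₖ |e^{2πi⟨hₖ,ξ⟩} - 1|^{2m}`. The conjugate factor is the symbol
of the opposite step, so it is smooth and goes into `Mⱼ`. -/
theorem exists_factorization_of_annulus (m : ℕ) {θ : E d → ℂ} (hθ : ContDiff ℝ (⊤ : ℕ∞) θ)
    (h0 : ∀ ξ, ‖ξ‖ ≤ 1 / 2 → θ ξ = 0) (h2 : ∀ ξ, 2 ≤ ‖ξ‖ → θ ξ = 0) :
    ∃ M : Fin d → E d → ℂ, (∀ j, ContDiff ℝ (⊤ : ℕ∞) (M j)) ∧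
      (∀ j ξ, 2 ≤ ‖ξ‖ → M j ξ = 0) ∧
      ∀ ξ, θ ξ = ∑ j, (translationSymbol (coordStep j) ξ - 1) ^ m * M j ξ := by
  refine ⟨fun j ξ => θ ξ * (translationSymbol (-coordStep j) ξ - 1) ^ m / diffSquareSum d m ξ,
    fun j => ?_, fun j ξ hξ => by simp [h2 ξ hξ], fun ξ => ?_⟩
  · exact contDiff_div_of_annulus hθ h0 h2
      (((contDiff_translationSymbol _).sub contDiff_const).pow m) (contDiff_diffSquareSum m)
      fun ξ => diffSquareSum_ne_zero m
  · by_cases hz : θ ξ = 0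
    · simp [hz]
    have hne : diffSquareSum d m ξ ≠ 0 := by
      refine diffSquareSum_ne_zero m ?_ ?_
      · rintro rfl
        exact hz (h0 0 (by simp))
      · by_contra! h
        exact hz (h2 ξ (by linarith))
    have : ∀ j, (translationSymbol (coordStep j) ξ - 1) ^ m *
        (θ ξ * (translationSymbol (-coordStep j) ξ - 1) ^ m / diffSquareSum d m ξ) =
        θ ξ / diffSquareSum d m ξ * ((translationSymbol (coordStep j) ξ - 1) *
          (translationSymbol (-coordStep j) ξ - 1)) ^ m := by
      intro j
      rw [mul_pow]; ring
    rw [Finset.sum_congr rfl fun j _ => this j, ← Finset.mul_sum]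
    exact (div_mul_cancel₀ _ hne).symm

/-! ### Complexification, real and imaginary parts of Schwartz functions -/

/-- A real Schwartz function as a complex one. -/
def ofRealS : 𝓢(E d, ℝ) →L[ℝ] 𝓢(E d, ℂ) := SchwartzMap.postcompCLM Complex.ofRealCLM

/-- The real part of a Schwartz function. -/
def reS : 𝓢(E d, ℂ) →L[ℝ] 𝓢(E d, ℝ) := SchwartzMap.postcompCLM Complex.reCLM

/-- The imaginary part of a Schwartz function. -/
def imS : 𝓢(E d, ℂ) →L[ℝ] 𝓢(E d, ℝ) := SchwartzMap.postcompCLM Complex.imCLM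

@[simp] theorem ofRealS_apply (u : 𝓢(E d, ℝ)) (x : E d) : ofRealS u x = (u x : ℂ) := rfl
@[simp] theorem reS_apply (u : 𝓢(E d, ℂ)) (x : E d) : reS u x = (u x).re := rfl
@[simp] theorem imS_apply (u : 𝓢(E d, ℂ)) (x : E d) : imS u x = (u x).im := rfl

theorem re_add_I_smul_im (φ : 𝓢(E d, ℂ)) :
    φ = ofRealS (reS φ) + Complex.I • ofRealS (imS φ) := by
  ext x
  simp only [add_apply, ofRealS_apply, reS_apply, smul_apply, imS_apply, smul_eq_mul]
  rw [mul_comm]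
  exact (Complex.re_add_im _).symm

theorem fourier_conj (f : E d → ℂ) (ξ : E d) :
    𝓕 (fun x => (starRingEnd ℂ) (f x)) ξ = (starRingEnd ℂ) (𝓕 f (-ξ)) := by
  rw [Real.fourier_eq', Real.fourier_eq', ← integral_conj]
  congr 1
  ext v
  simp only [smul_eq_mul, map_mul, ← Complex.exp_conj]
  congr 2
  simp [inner_neg_right, Complex.conj_ofNat]

theorem fourier_ofRealS_reS (φ : 𝓢(E d, ℂ)) (ξ : E d) :
    𝓕 (ofRealS (reS φ)) ξ = (𝓕 φ ξ + (starRingEnd ℂ) (𝓕 φ (-ξ))) / 2 := by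
  have hc := fourier_conj φ ξ
  rw [SchwartzMap.fourier_coe, SchwartzMap.fourier_coe, ← hc, Real.fourier_eq, Real.fourier_eq,
    Real.fourier_eq]
  have hi := (Real.fourierIntegral_convergent_iff (μ := volume) ξ).2 (φ.integrable (μ := volume))
  have hi2 : Integrable (fun v => (starRingEnd ℂ) (φ v)) volume :=
    (φ.integrable (μ := volume)).congr' (by
      exact (Complex.continuous_conj.comp φ.continuous).aestronglyMeasurable) (by simp)
  have hi2' := (Real.fourierIntegral_convergent_iff (μ := volume) ξ).2 hi2
  rw [← integral_add hi hi2', ← integral_div]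
  congr 1
  ext v
  simp only [ofRealS_apply, reS_apply, Circle.smul_def, smul_eq_mul]
  rw [← mul_add, mul_div_assoc, Complex.add_conj]
  push_cast
  ring

theorem imS_eq_reS (φ : 𝓢(E d, ℂ)) : imS φ = reS ((-Complex.I) • φ) := by
  ext x
  simp

/-- Taking real parts mixes only the frequencies `ξ` and `-ξ`, so band-limitation to a centred ball
survives. This matters because the hypotheses concern real test functions while the multipliers
produce complex ones. -/
theorem fourier_ofRealS_reS_eq_zero {φ : 𝓢(E d, ℂ)} {R : ℝ}
    (h : ∀ ξ, R ≤ ‖ξ‖ → 𝓕 φ ξ = 0) (ξ : E d) (hξ : R ≤ ‖ξ‖) : 𝓕 (ofRealS (reS φ)) ξ = 0 := by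
  rw [fourier_ofRealS_reS, h ξ hξ, h (-ξ) (by simpa using hξ)]
  simp

theorem fourier_ofRealS_imS_eq_zero {φ : 𝓢(E d, ℂ)} {R : ℝ}
    (h : ∀ ξ, R ≤ ‖ξ‖ → 𝓕 φ ξ = 0) (ξ : E d) (hξ : R ≤ ‖ξ‖) : 𝓕 (ofRealS (imS φ)) ξ = 0 := by
  rw [imS_eq_reS]
  refine fourier_ofRealS_reS_eq_zero (fun η hη => ?_) ξ hξ
  rw [FourierTransform.fourier_smul, smul_apply, h η hη, smul_zero]

theorem schwartzDiff_iterate_ofRealS (h : E d) (m : ℕ) (u : 𝓢(E d, ℝ)) :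
    (schwartzDiff h)^[m] (ofRealS u) = ofRealS ((schwartzDiff h)^[m] u) := by
  have : Function.Semiconj (ofRealS : 𝓢(E d, ℝ) → 𝓢(E d, ℂ)) (schwartzDiff h) (schwartzDiff h) := by
    intro u
    ext x
    simp [schwartzDiff_apply]
  exact ((this.iterate_right m) u).symm

theorem schwartzDiff_iterate_smul (h : E d) (m : ℕ) (c : ℂ) (φ : 𝓢(E d, ℂ)) :
    (schwartzDiff h)^[m] (c • φ) = c • (schwartzDiff h)^[m] φ := by
  have : Function.Semiconj (fun φ : 𝓢(E d, ℂ) => c • φ) (schwartzDiff h) (schwartzDiff h) := by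
    intro u
    ext x
    simp [schwartzDiff_apply, mul_sub]
  exact ((this.iterate_right m) φ).symm

theorem schwartzDiff_iterate_eq (h : E d) (m : ℕ) (φ : 𝓢(E d, ℂ)) :
    (schwartzDiff h)^[m] φ = ofRealS ((schwartzDiff h)^[m] (reS φ)) +
      Complex.I • ofRealS ((schwartzDiff h)^[m] (imS φ)) := by
  conv_lhs => rw [re_add_I_smul_im φ]
  rw [iterate_map_add, schwartzDiff_iterate_smul, schwartzDiff_iterate_ofRealS,
    schwartzDiff_iterate_ofRealS]

/-! ### The blocks as Fourier multipliers -/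

theorem fourier_fourierMultiplierCLM {a : E d → ℂ} (ha : a.HasTemperateGrowth)
    (φ : 𝓢(E d, ℂ)) (ξ : E d) :
    𝓕 (SchwartzMap.fourierMultiplierCLM ℂ a φ) ξ = a ξ * 𝓕 φ ξ := by
  rw [SchwartzMap.fourierMultiplierCLM_apply, FourierTransform.fourier_fourierInv_eq,
    SchwartzMap.smulLeftCLM_apply_apply ha, smul_eq_mul]

theorem schwartz_ext_fourier {φ ψ : 𝓢(E d, ℂ)} (h : ∀ ξ, 𝓕 φ ξ = 𝓕 ψ ξ) : φ = ψ := by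
  have : 𝓕 φ = 𝓕 ψ := SchwartzMap.ext h
  calc φ = 𝓕⁻ (𝓕 φ) := (FourierTransform.fourierInv_fourier_eq φ).symm
    _ = ψ := by rw [this, FourierTransform.fourierInv_fourier_eq]

/-- The dyadic annular profile `χ(ξ) - χ(2ξ)`, of which all the symbols `φₙ`, `n ≥ 1`, are
dilations. -/
def Cutoff.profile (χ : Cutoff d) (ξ : E d) : ℂ :=
  ((χ.toFun ξ - χ.toFun ((2 : ℝ) • ξ) : ℝ) : ℂ)

theorem contDiff_ofReal_comp {f : E d → ℝ} (hf : ContDiff ℝ (⊤ : ℕ∞) f) :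
    ContDiff ℝ (⊤ : ℕ∞) fun ξ => (f ξ : ℂ) :=
  Complex.ofRealCLM.contDiff.comp hf

theorem Cutoff.contDiff_profile (χ : Cutoff d) : ContDiff ℝ (⊤ : ℕ∞) χ.profile :=
  contDiff_ofReal_comp (χ.smooth.sub (contDiff_comp_const_smul χ.smooth 2))

theorem Cutoff.profile_eq_zero_of_le (χ : Cutoff d) {ξ : E d} (h : ‖ξ‖ ≤ 1 / 2) :
    χ.profile ξ = 0 := by
  rw [profile, χ.eq_one ξ (by linarith), χ.eq_one _ (by rw [norm_smul]; norm_num; linarith)]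
  simp

theorem Cutoff.profile_eq_zero_of_ge (χ : Cutoff d) {ξ : E d} (h : 2 ≤ ‖ξ‖) :
    χ.profile ξ = 0 := by
  rw [profile, χ.eq_zero ξ h, χ.eq_zero _ (by rw [norm_smul]; norm_num; linarith)]
  simp

theorem Cutoff.symbol_succ (χ : Cutoff d) (n : ℕ) :
    (fun ξ => (χ.symbol (n + 1) ξ : ℂ)) = fun ξ => χ.profile (((2 : ℝ) ^ (n + 1))⁻¹ • ξ) := by
  ext ξ
  rw [Cutoff.symbol, profile, smul_smul]
  congr 4
  rw [pow_succ]
  field_simp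

theorem Cutoff.contDiff_symbol (χ : Cutoff d) (n : ℕ) :
    ContDiff ℝ (⊤ : ℕ∞) fun ξ => (χ.symbol n ξ : ℂ) := by
  cases n with
  | zero => exact contDiff_ofReal_comp χ.smooth
  | succ n =>
    rw [χ.symbol_succ]
    exact contDiff_comp_const_smul χ.contDiff_profile _

theorem Cutoff.hasCompactSupport_symbol (χ : Cutoff d) (n : ℕ) :
    HasCompactSupport fun ξ => (χ.symbol n ξ : ℂ) := by
  cases n with
  | zero => exact hasCompactSupport_of_eq_zero (R := 2) fun ξ h => by simp [symbol, χ.eq_zero ξ h]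
  | succ n =>
    rw [χ.symbol_succ]
    exact hasCompactSupport_comp_const_smul
      (hasCompactSupport_of_eq_zero fun _ => χ.profile_eq_zero_of_ge) (by positivity)

theorem Cutoff.symbol_eq_zero_of_le (χ : Cutoff d) {n : ℕ} {ξ : E d}
    (h : ‖ξ‖ ≤ 2 ^ n) : (χ.symbol (n + 1) ξ : ℂ) = 0 := by
  refine (congrFun (χ.symbol_succ n) ξ).trans ?_
  refine χ.profile_eq_zero_of_le ?_
  rw [norm_smul, norm_inv, Real.norm_of_nonneg (by positivity), inv_mul_le_iff₀ (by positivity),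
    pow_succ]
  linarith

/-- The supremum of the masses of the kernels. -/
def Cutoff.mass (χ : Cutoff d) : ℝ≥0∞ :=
  (∫⁻ x, ‖𝓕⁻ (fun ξ => (χ.symbol 0 ξ : ℂ)) x‖ₑ) + ∫⁻ x, ‖𝓕⁻ χ.profile x‖ₑ

theorem Cutoff.mass_lt_top (χ : Cutoff d) : χ.mass < ∞ :=
  ENNReal.add_lt_top.2 ⟨lintegral_enorm_fourierInv_lt_top (χ.contDiff_symbol 0)
    (χ.hasCompactSupport_symbol 0), lintegral_enorm_fourierInv_lt_top χ.contDiff_profile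
    (hasCompactSupport_of_eq_zero fun _ => χ.profile_eq_zero_of_ge)⟩

/-- All symbols with `n ≥ 1` are dilations of one profile, so only two masses occur. -/
theorem Cutoff.lintegral_kernel_le (χ : Cutoff d) (n : ℕ) :
    ∫⁻ x, ‖χ.kernel n x‖ₑ ≤ χ.mass := by
  cases n with
  | zero => exact le_self_add
  | succ n =>
    rw [kernel, χ.symbol_succ, lintegral_enorm_fourierInv_comp_smul _ (by positivity)]
    exact le_add_self

theorem Cutoff.block_eq (χ : Cutoff d) (n : ℕ) (u : 𝓢(E d, ℝ)) :
    χ.block n u =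
      SchwartzMap.fourierMultiplierCLM ℂ (fun ξ => (χ.symbol n ξ : ℂ)) (ofRealS u) := by
  ext x
  rw [fourierMultiplierCLM_eq_convolution (χ.contDiff_symbol n) (χ.hasCompactSupport_symbol n)]
  rw [block, convolution_def]
  rfl

theorem Cutoff.measurable_enorm_kernel (χ : Cutoff d) (n : ℕ) :
    Measurable fun x => ‖χ.kernel n x‖ₑ :=
  measurable_enorm_fourierInv (χ.contDiff_symbol n) (χ.hasCompactSupport_symbol n)

theorem Cutoff.eLpNorm_block_le (χ : Cutoff d) (n : ℕ) {f : E d → ℝ}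
    (hf : AEStronglyMeasurable f volume) {r : ℝ≥0∞} (hr : 1 ≤ r) :
    eLpNorm (χ.block n f) r volume ≤ χ.mass * eLpNorm f r volume := by
  refine (eLpNorm_le_of_enorm_le_lconvolution hf (χ.measurable_enorm_kernel n) hr
    fun x => ?_).trans (by gcongr; exact χ.lintegral_kernel_le n)
  rw [block, convolution_def]
  refine (enorm_integral_le_lintegral_enorm _).trans_eq (lintegral_congr fun t => ?_)
  rw [ContinuousLinearMap.lsmul_apply, enorm_smul]

/-! ### Besov norms of band-limited functions -/

theorem besovNorm_one (χ : Cutoff d) (α : ℝ) (r : ℝ≥0∞) (f : E d → ℝ) :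
    besovNorm χ α r 1 f =
      ∑' n : ℕ, (2 : ℝ≥0∞) ^ ((n : ℝ) * α) * eLpNorm (χ.block n f) r volume := by
  rw [besovNorm, eLpNorm_one_eq_lintegral_enorm, lintegral_count]
  simp

/-- For `α > 0` a geometric sum is comparable with its last term; `S` is the sum of the reversed
series. -/
theorem exists_sum_two_rpow_le {α : ℝ} (hα : 0 < α) :
    ∃ S : ℝ≥0∞, S ≠ ∞ ∧ ∀ n : ℕ,
      ∑ l ∈ Finset.range (n + 1), (2 : ℝ≥0∞) ^ ((l : ℝ) * α) ≤ S * 2 ^ ((n : ℝ) * α) := by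
  set b : ℝ≥0∞ := 2 ^ α with hb
  have hb1 : 1 < b := ENNReal.one_lt_rpow (by norm_num) hα
  have hbt : b ≠ ∞ := ENNReal.rpow_ne_top_of_nonneg hα.le (by norm_num)
  have hb0 : b ≠ 0 := (zero_lt_one.trans hb1).ne'
  have hpow : ∀ l : ℕ, (2 : ℝ≥0∞) ^ ((l : ℝ) * α) = b ^ l := by
    intro l
    rw [hb, ← ENNReal.rpow_natCast, ← ENNReal.rpow_mul, mul_comm]
  simp only [hpow]
  refine ⟨∑' j : ℕ, b⁻¹ ^ j, ?_, fun n => ?_⟩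
  · rw [ENNReal.tsum_geometric, ne_eq, ENNReal.inv_eq_top, tsub_eq_zero_iff_le, not_le]
    exact ENNReal.inv_lt_one.2 hb1
  -- This relation closes the induction: `S bⁿ + bⁿ⁺¹ = S bⁿ⁺¹`.
  · have hS : ∑' j : ℕ, b⁻¹ ^ j = 1 + b⁻¹ * ∑' j : ℕ, b⁻¹ ^ j := by
      conv_lhs => rw [tsum_eq_zero_add' ENNReal.summable]
      rw [← ENNReal.tsum_mul_left]
      simp [pow_succ']
    induction n with
    | zero =>
      simp only [zero_add, Finset.range_one, Finset.sum_singleton, pow_zero, mul_one]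
      rw [hS]
      exact le_self_add
    | succ n ih =>
      rw [Finset.sum_range_succ]
      refine (add_le_add_left ih _).trans_eq ?_
      conv_rhs => rw [hS]
      rw [add_mul, one_mul, add_comm, pow_succ']
      congr 1
      have : b⁻¹ * b = 1 := ENNReal.inv_mul_cancel hb0 hbt
      calc (∑' j : ℕ, b⁻¹ ^ j) * b ^ n = (b⁻¹ * b) * ((∑' j : ℕ, b⁻¹ ^ j) * b ^ n) := by
            rw [this, one_mul]
        _ = _ := by ring

/-- A Bernstein-type bound. The block `l = k + 1` sees only frequencies above `2ᵏ`, so the blocks `l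
≥ n + 2` vanish. Each remaining one is controlled by Young's inequality, and the weights sum
geometrically. -/
theorem exists_besovNorm_one_le_of_bandlimited (χ : Cutoff d) {α : ℝ} (hα : 0 < α) {r : ℝ≥0∞}
    (hr : 1 ≤ r) :
    ∃ C : ℝ≥0∞, C ≠ ∞ ∧ ∀ (n : ℕ) (u : 𝓢(E d, ℝ)),
      (∀ ξ, 2 ^ (n + 1) ≤ ‖ξ‖ → 𝓕 (ofRealS u) ξ = 0) →
      besovNorm χ α r 1 u ≤ C * 2 ^ ((n : ℝ) * α) * eLpNorm u r volume := by
  obtain ⟨S, hS, hSn⟩ := exists_sum_two_rpow_le hα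
  refine ⟨S * 2 ^ α * χ.mass, ENNReal.mul_ne_top (ENNReal.mul_ne_top hS
    (ENNReal.rpow_ne_top_of_nonneg hα.le (by norm_num))) χ.mass_lt_top.ne, fun n u hu => ?_⟩
  rw [besovNorm_one, tsum_eq_sum (s := Finset.range (n + 1 + 1))]
  · calc ∑ l ∈ Finset.range (n + 1 + 1), (2 : ℝ≥0∞) ^ ((l : ℝ) * α) * eLpNorm (χ.block l u) r volume
        ≤ ∑ l ∈ Finset.range (n + 1 + 1), (2 : ℝ≥0∞) ^ ((l : ℝ) * α) *
          (χ.mass * eLpNorm u r volume) := by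
          gcongr
          exact χ.eLpNorm_block_le _ u.continuous.aestronglyMeasurable hr
      _ ≤ S * 2 ^ (((n + 1 : ℕ) : ℝ) * α) * (χ.mass * eLpNorm u r volume) := by
          rw [← Finset.sum_mul]
          gcongr
          exact hSn _
      _ = _ := by
          have : (2 : ℝ≥0∞) ^ (((n + 1 : ℕ) : ℝ) * α) = 2 ^ α * 2 ^ ((n : ℝ) * α) := by
            rw [← ENNReal.rpow_add _ _ (by norm_num) (by norm_num)]
            congr 1
            push_cast; ring
          rw [this]; ring
  · intro l hl
    simp only [Finset.mem_range, not_lt] at hl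
    obtain ⟨k, rfl⟩ : ∃ k, l = k + 1 := ⟨l - 1, by omega⟩
    rw [χ.block_eq]
    have : SchwartzMap.fourierMultiplierCLM ℂ (fun ξ => (χ.symbol (k + 1) ξ : ℂ)) (ofRealS u) = 0 := by
      refine schwartz_ext_fourier fun ξ => ?_
      rw [fourier_fourierMultiplierCLM (hasTemperateGrowth_of_hasCompactSupport
        (χ.contDiff_symbol _) (χ.hasCompactSupport_symbol _))]
      have h0 : 𝓕 (0 : 𝓢(E d, ℂ)) = 0 := map_zero (FourierTransform.fourierCLM ℂ 𝓢(E d, ℂ))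
      rw [h0, zero_apply]
      rcases le_total ‖ξ‖ (2 ^ k) with h | h
      · rw [χ.symbol_eq_zero_of_le h, zero_mul]
      · rw [hu ξ ((pow_le_pow_right₀ (by norm_num) (by omega)).trans h), mul_zero]
    rw [this]
    have : ⇑(0 : 𝓢(E d, ℂ)) = 0 := rfl
    simp [this]

/-! ### The smoothing estimate for functionals on the Schwartz space -/

theorem fourierMultiplierCLM_eq_sum_schwartzDiff {ι : Type*} [Fintype ι] {a : E d → ℂ}
    (ha : a.HasTemperateGrowth) {M : ι → E d → ℂ} (hM : ∀ j, (M j).HasTemperateGrowth)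
    {h : ι → E d} (m : ℕ)
    (hsum : ∀ ξ, a ξ = ∑ j, (translationSymbol (h j) ξ - 1) ^ m * M j ξ) (g : 𝓢(E d, ℂ)) :
    SchwartzMap.fourierMultiplierCLM ℂ a g =
      ∑ j, (schwartzDiff (h j))^[m] (SchwartzMap.fourierMultiplierCLM ℂ (M j) g) := by
  refine schwartz_ext_fourier fun ξ => ?_
  have h1 : 𝓕 (∑ j, (schwartzDiff (h j))^[m] (SchwartzMap.fourierMultiplierCLM ℂ (M j) g)) =
      ∑ j, 𝓕 ((schwartzDiff (h j))^[m] (SchwartzMap.fourierMultiplierCLM ℂ (M j) g)) :=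
    map_sum (FourierTransform.fourierCLM ℂ 𝓢(E d, ℂ)) _ _
  rw [h1, sum_apply, fourier_fourierMultiplierCLM ha, hsum, Finset.sum_mul]
  refine Finset.sum_congr rfl fun j _ => ?_
  rw [fourier_schwartzDiff_iterate, fourier_fourierMultiplierCLM (hM j), mul_assoc]

/-- If a functional gains `s` derivatives on `m`-th order differences, relative to the norm of
`B^α_{r,1}`, then it is of size `2^{-n(s-α)}` on frequencies of order `2ⁿ`. -/
theorem exists_enorm_fourierMultiplierCLM_le (χ : Cutoff d) (m : ℕ) (s : ℝ) {α : ℝ} (hα : 0 < α)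
    {r : ℝ≥0∞} (hr : 1 ≤ r) {θ : E d → ℂ} (hθ : ContDiff ℝ (⊤ : ℕ∞) θ)
    (h0 : ∀ ξ, ‖ξ‖ ≤ 1 / 2 → θ ξ = 0) (h2 : ∀ ξ, 2 ≤ ‖ξ‖ → θ ξ = 0) :
    ∃ C : ℝ≥0∞, C ≠ ∞ ∧ ∀ (T : 𝓢(E d, ℂ) →ₗ[ℂ] ℂ) (K : ℝ), 0 ≤ K →
      (∀ (u : 𝓢(E d, ℝ)) (h : E d), ‖h‖ ≤ 1 → ‖T (ofRealS ((schwartzDiff h)^[m] u))‖ₑ ≤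
        ENNReal.ofReal (K * ‖h‖ ^ s) * besovNorm χ α r 1 u) →
      ∀ (n : ℕ) (g : 𝓢(E d, ℂ)),
        ‖T (SchwartzMap.fourierMultiplierCLM ℂ (fun ξ => θ (((2 : ℝ) ^ n)⁻¹ • ξ)) g)‖ₑ ≤
          C * ENNReal.ofReal K * 2 ^ (-((n : ℝ) * (s - α))) * eLpNorm g r volume := by
  obtain ⟨M, hMs, hM2, hMsum⟩ := exists_factorization_of_annulus m hθ h0 h2
  obtain ⟨C₀, hC₀, hband⟩ := exists_besovNorm_one_le_of_bandlimited χ hα hr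
  have hMc : ∀ j, HasCompactSupport (M j) := fun j => hasCompactSupport_of_eq_zero (hM2 j)
  -- The factor `2` counts real and imaginary parts, `(1/8)^s` comes from the step length, `C₀` from
  -- band-limitation, and the integral is the mass of the kernel of `Mⱼ`.
  refine ⟨∑ j, 2 * ENNReal.ofReal ((1 / 8) ^ s) * C₀ * ∫⁻ x, ‖𝓕⁻ (M j) x‖ₑ, ?_,
    fun T K hK hT n g => ?_⟩
  · refine (ENNReal.sum_lt_top.2 fun j _ => ?_).ne
    exact ENNReal.mul_lt_top (ENNReal.mul_lt_top (by finiteness) hC₀.lt_top)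
      (lintegral_enorm_fourierInv_lt_top (hMs j) (hMc j))
  set c : ℝ := ((2 : ℝ) ^ n)⁻¹ with hc
  have hc0 : 0 < c := by positivity
  have hc1 : c ≤ 1 := inv_le_one_of_one_le₀ (one_le_pow₀ (by norm_num))
  have hθc : HasCompactSupport θ := hasCompactSupport_of_eq_zero h2
  have hMn : ∀ j, ContDiff ℝ (⊤ : ℕ∞) fun ξ => M j (c • ξ) := fun j =>
    contDiff_comp_const_smul (hMs j) c
  have hMnc : ∀ j, HasCompactSupport fun ξ => M j (c • ξ) := fun j =>
    hasCompactSupport_comp_const_smul (hMc j) hc0.ne'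
  -- Dilating the factorization by `2⁻ⁿ` in frequency replaces the steps `hⱼ` by `2⁻ⁿhⱼ`.
  have hdec := fourierMultiplierCLM_eq_sum_schwartzDiff (h := fun j => c • coordStep j)
    (hasTemperateGrowth_of_hasCompactSupport (contDiff_comp_const_smul hθ c)
      (hasCompactSupport_comp_const_smul hθc hc0.ne'))
    (fun j => hasTemperateGrowth_of_hasCompactSupport (hMn j) (hMnc j)) m
    (fun ξ => by simp_rw [translationSymbol_smul]; exact hMsum (c • ξ)) g
  rw [hdec, map_sum]
  have hsum : ∀ j, ‖T ((schwartzDiff (c • coordStep j))^[m]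
      (SchwartzMap.fourierMultiplierCLM ℂ (fun ξ => M j (c • ξ)) g))‖ₑ ≤
      2 * ENNReal.ofReal ((1 / 8) ^ s) * C₀ * (∫⁻ x, ‖𝓕⁻ (M j) x‖ₑ) * ENNReal.ofReal K *
        2 ^ (-((n : ℝ) * (s - α))) * eLpNorm g r volume := by
    intro j
    set φ := SchwartzMap.fourierMultiplierCLM ℂ (fun ξ => M j (c • ξ)) g with hφ
    have hφ0 : ∀ ξ, 2 ^ (n + 1) ≤ ‖ξ‖ → 𝓕 φ ξ = 0 := by
      intro ξ hξ
      rw [hφ, fourier_fourierMultiplierCLM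
        (hasTemperateGrowth_of_hasCompactSupport (hMn j) (hMnc j)), hM2 j (c • ξ), zero_mul]
      rw [norm_smul, Real.norm_of_nonneg hc0.le, hc, le_inv_mul_iff₀ (by positivity)]
      simpa [pow_succ] using hξ
    have hφr : eLpNorm φ r volume ≤ (∫⁻ x, ‖𝓕⁻ (M j) x‖ₑ) * eLpNorm g r volume := by
      have := eLpNorm_fourierMultiplierCLM_le (hMn j) (hMnc j) g hr
      rwa [lintegral_enorm_fourierInv_comp_smul _ hc0] at this
    have hnorm : ‖c • coordStep j‖ = c * (1 / 8) := by
      rw [norm_smul, norm_coordStep, Real.norm_of_nonneg hc0.le]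
    have hpow : ENNReal.ofReal (K * ‖c • coordStep j‖ ^ s) =
        ENNReal.ofReal K * 2 ^ (-((n : ℝ) * s)) * ENNReal.ofReal ((1 / 8) ^ s) := by
      rw [hnorm, Real.mul_rpow hc0.le (by norm_num), ← mul_assoc, ENNReal.ofReal_mul (by positivity),
        ENNReal.ofReal_mul hK]
      congr 2
      rw [hc, Real.inv_rpow (by positivity), ← Real.rpow_natCast, ← Real.rpow_mul (by norm_num),
        ← Real.rpow_neg (by norm_num), ← ENNReal.ofReal_rpow_of_pos (by norm_num)]
      simp
    have hstep : ∀ u : 𝓢(E d, ℝ), (∀ ξ, 2 ^ (n + 1) ≤ ‖ξ‖ → 𝓕 (ofRealS u) ξ = 0) →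
        eLpNorm u r volume ≤ eLpNorm φ r volume →
        ‖T (ofRealS ((schwartzDiff (c • coordStep j))^[m] u))‖ₑ ≤
        ENNReal.ofReal ((1 / 8) ^ s) * C₀ * (∫⁻ x, ‖𝓕⁻ (M j) x‖ₑ) * ENNReal.ofReal K *
        2 ^ (-((n : ℝ) * (s - α))) * eLpNorm g r volume := by
      intro u hu hur
      refine (hT u (c • coordStep j) (by rw [hnorm]; linarith)).trans ?_
      rw [hpow]
      calc _ ≤ ENNReal.ofReal K * 2 ^ (-((n : ℝ) * s)) * ENNReal.ofReal ((1 / 8) ^ s) *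
            (C₀ * 2 ^ ((n : ℝ) * α) * ((∫⁻ x, ‖𝓕⁻ (M j) x‖ₑ) * eLpNorm g r volume)) := by
            gcongr
            exact (hband n u hu).trans (by gcongr; exact hur.trans hφr)
        _ = _ := by
            have : (2 : ℝ≥0∞) ^ (-((n : ℝ) * (s - α))) =
                2 ^ (-((n : ℝ) * s)) * 2 ^ ((n : ℝ) * α) := by
              rw [← ENNReal.rpow_add _ _ (by norm_num) (by norm_num)]
              congr 1
              ring
            rw [this]; ring
    -- The functional is complex linear, so the bound for real functions applies to both parts of
    -- `φ`, which inherit its band and have no larger `L^r` norm.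
    rw [schwartzDiff_iterate_eq, map_add, map_smul]
    refine (enorm_add_le _ _).trans ?_
    rw [enorm_smul]
    have hI : ‖Complex.I‖ₑ = 1 := by simp [← ofReal_norm]
    rw [hI, one_mul]
    refine (add_le_add
      (hstep (reS φ) (fourier_ofRealS_reS_eq_zero hφ0)
        (eLpNorm_mono fun x => by simpa using Complex.abs_re_le_norm (φ x)))
      (hstep (imS φ) (fourier_ofRealS_imS_eq_zero hφ0)
        (eLpNorm_mono fun x => by simpa using Complex.abs_im_le_norm (φ x)))).trans_eq ?_
    rw [← two_mul]
    ring
  refine (enorm_sum_le _ _).trans ((Finset.sum_le_sum fun j _ => hsum j).trans_eq ?_)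
  simp_rw [Finset.sum_mul]

/-! ### Comparison with the norm of `B^α_{r,1}` -/

theorem eLpNorm_top_count_le {ι : Type*} [MeasurableSpace ι] [MeasurableSingletonClass ι]
    {a : ι → ℝ≥0∞} {c : ℝ≥0∞} (h : ∀ i, a i ≤ c) : eLpNorm a ∞ Measure.count ≤ c := by
  rw [eLpNorm_exponent_top]
  exact essSup_le_of_ae_le _ (Filter.Eventually.of_forall fun n => by simpa using h n)

theorem besovNorm_top_le_one (χ : Cutoff d) (α : ℝ) (r : ℝ≥0∞) (f : E d → ℝ) :
    besovNorm χ α r ∞ f ≤ besovNorm χ α r 1 f := by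
  rw [besovNorm_one, besovNorm]
  exact eLpNorm_top_count_le fun n => ENNReal.le_tsum n

/-- The embedding of `ℓ¹` in `ℓ^q`: in `b_i^q = b_i · b_i^{q-1}` the second factor is at most the
corresponding power of the whole sum. -/
theorem tsum_rpow_le {ι : Type*} (b : ι → ℝ≥0∞) {q : ℝ} (hq : 1 ≤ q) :
    ∑' i, b i ^ q ≤ (∑' i, b i) ^ q := by
  have hsplit : ∀ x : ℝ≥0∞, x ^ q = x * x ^ (q - 1) := by
    intro x
    nth_rw 2 [← ENNReal.rpow_one x]
    rw [← ENNReal.rpow_add_of_nonneg _ _ zero_le_one (by linarith)]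
    congr 1
    ring
  rw [hsplit, ← ENNReal.tsum_mul_right]
  refine ENNReal.tsum_le_tsum fun i => ?_
  rw [hsplit]
  gcongr
  exact ENNReal.le_tsum i

/-- Pointwise, the supremum over `n` is at most the `ℓ^q` norm. By Tonelli the `L^q` norm of the
latter is an `ℓ^q` norm of `L^q` norms, which the `ℓ¹` norm dominates. -/
theorem triebelLizorkinNorm_top_le (χ : Cutoff d) (α : ℝ) {q : ℝ} (hq : 1 ≤ q) {f : E d → ℝ}
    (hf : ∀ n, AEStronglyMeasurable (χ.block n f) volume) :
    triebelLizorkinNorm χ α (ENNReal.ofReal q) ∞ f ≤ besovNorm χ α (ENNReal.ofReal q) 1 f := by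
  have hq0 : 0 < q := by linarith
  rw [besovNorm_one, triebelLizorkinNorm,
    eLpNorm_eq_lintegral_rpow_enorm_toReal (by simpa using hq0) ENNReal.ofReal_ne_top,
    ENNReal.toReal_ofReal hq0.le]
  rw [one_div, ENNReal.rpow_inv_le_iff hq0]
  have h1 : ∀ x, ‖eLpNorm (fun n : ℕ => (2 : ℝ≥0∞) ^ ((n : ℝ) * α) * ‖χ.block n f x‖ₑ) ∞
      Measure.count‖ₑ ^ q ≤ ∑' n : ℕ, ((2 : ℝ≥0∞) ^ ((n : ℝ) * α) * ‖χ.block n f x‖ₑ) ^ q := by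
    intro x
    rw [enorm_eq_self, ← ENNReal.le_rpow_inv_iff hq0]
    refine eLpNorm_top_count_le fun n => ?_
    rw [ENNReal.le_rpow_inv_iff hq0]
    exact ENNReal.le_tsum (f := fun n : ℕ => ((2 : ℝ≥0∞) ^ ((n : ℝ) * α) * ‖χ.block n f x‖ₑ) ^ q) n
  refine (lintegral_mono h1).trans ?_
  rw [lintegral_tsum fun n => (((hf n).enorm).const_mul _).pow_const _]
  refine le_trans (le_of_eq ?_) (tsum_rpow_le _ hq)
  congr 1
  ext n
  simp_rw [ENNReal.mul_rpow_of_nonneg _ _ hq0.le]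
  rw [lintegral_const_mul'' _ ((hf n).enorm.pow_const _),
    eLpNorm_eq_lintegral_rpow_enorm_toReal (by simpa using hq0) ENNReal.ofReal_ne_top,
    ENNReal.toReal_ofReal hq0.le, one_div, ENNReal.rpow_inv_rpow hq0.ne']

/-! ### Norms by duality with smooth compactly supported functions -/

/-- Smooth functions are not dense in `L^∞`, so norm approximation is unavailable. Mollification
keeps the bound `1` and converges almost everywhere, and `‖F‖` dominates the integrands. -/
theorem enorm_integral_mul_le_of_contDiff_of_le_one {F G : E d → ℝ} (hF : Integrable F)
    (hG : AEStronglyMeasurable G volume) (hG1 : ∀ x, ‖G x‖ ≤ 1) (hGc : HasCompactSupport G)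
    {B : ℝ≥0∞} (h : ∀ g : E d → ℝ, ContDiff ℝ (⊤ : ℕ∞) g → HasCompactSupport g →
      ‖∫ x, g x * F x‖ₑ ≤ B * eLpNorm g ∞ volume) :
    ‖∫ x, G x * F x‖ₑ ≤ B := by
  have hGi : Integrable G := by
    have h1 : Integrable ((tsupport G).indicator fun _ => (1 : ℝ)) volume :=
      (integrable_indicator_iff (isClosed_tsupport G).measurableSet).2
        (integrableOn_const hGc.isCompact.measure_lt_top.ne)
    refine h1.mono hG ?_
    refine Filter.Eventually.of_forall fun x => ?_
    by_cases hx : x ∈ tsupport G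
    · simpa [hx] using hG1 x
    · simp [image_eq_zero_of_notMem_tsupport hx]
  -- The ratio `2` of the radii stays fixed while they shrink, as almost everywhere convergence of
  -- the mollifications requires.
  let φ : ℕ → ContDiffBump (0 : E d) := fun n =>
    ⟨1 / (n + 1), 2 / (n + 1), by positivity, by gcongr; norm_num⟩
  set g : ℕ → E d → ℝ := fun n => (φ n).normed volume ⋆[ContinuousLinearMap.lsmul ℝ ℝ, volume] G
    with hg
  have hgs : ∀ n, ContDiff ℝ (⊤ : ℕ∞) (g n) := fun n =>
    (φ n).hasCompactSupport_normed.contDiff_convolution_left _ (φ n).contDiff_normed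
      hGi.locallyIntegrable
  have hgc : ∀ n, HasCompactSupport (g n) := fun n =>
    (φ n).hasCompactSupport_normed.convolution _ hGc
  have hg1 : ∀ n x, ‖g n x‖ ≤ 1 := by
    intro n x
    rw [hg]
    simp only [convolution_def]
    rw [← (φ n).integral_normed (μ := (volume : Measure (E d)))]
    refine norm_integral_le_of_norm_le (φ n).integrable_normed
      (Filter.Eventually.of_forall fun t => ?_)
    rw [ContinuousLinearMap.lsmul_apply, norm_smul, Real.norm_of_nonneg ((φ n).nonneg_normed t)]
    exact mul_le_of_le_one_right ((φ n).nonneg_normed t) (hG1 _)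
  have hlim : ∀ᵐ x ∂(volume : Measure (E d)), Filter.Tendsto (fun n => g n x) Filter.atTop
      (nhds (G x)) := by
    refine ContDiffBump.ae_convolution_tendsto_right_of_locallyIntegrable (K := 2) ?_ ?_
      hGi.locallyIntegrable
    · simpa [φ, div_eq_mul_inv] using
        (tendsto_one_div_add_atTop_nhds_zero_nat (𝕜 := ℝ)).const_mul 2
    · refine Filter.Eventually.of_forall fun n => le_of_eq ?_
      simp only [φ]
      ring
  have ht : Filter.Tendsto (fun n => ∫ x, g n x * F x) Filter.atTop (nhds (∫ x, G x * F x)) := by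
    refine tendsto_integral_of_dominated_convergence (fun x => ‖F x‖) (fun n => ?_) hF.norm
      (fun n => Filter.Eventually.of_forall fun x => ?_) ?_
    · exact (hgs n).continuous.aestronglyMeasurable.mul hF.aestronglyMeasurable
    · rw [norm_mul]
      exact mul_le_of_le_one_left (norm_nonneg _) (hg1 n x)
    · filter_upwards [hlim] with x hx
      exact hx.mul_const _
  refine le_of_tendsto ht.enorm (Filter.Eventually.of_forall fun n => ?_)
  refine (h (g n) (hgs n) (hgc n)).trans ?_
  have : eLpNorm (g n) ∞ volume ≤ 1 := by
    rw [eLpNorm_exponent_top]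
    refine (eLpNormEssSup_le_of_ae_bound (C := 1) (Filter.Eventually.of_forall (hg1 n))).trans ?_
    simp
  exact mul_le_of_le_one_right' this

/-- The sign of `F`, cut off to a ball, recovers the integral of `|F|` over that ball; the balls
then exhaust the space. -/
theorem eLpNorm_one_le_of_forall_contDiff {F : E d → ℝ} (hF : Integrable F) {B : ℝ≥0∞}
    (h : ∀ g : E d → ℝ, ContDiff ℝ (⊤ : ℕ∞) g → HasCompactSupport g →
      ‖∫ x, g x * F x‖ₑ ≤ B * eLpNorm g ∞ volume) :
    eLpNorm F 1 volume ≤ B := by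
  rw [eLpNorm_one_eq_lintegral_enorm]
  have hcov : AECover (volume : Measure (E d)) Filter.atTop
      (fun n : ℕ => Metric.closedBall (0 : E d) n) :=
    aecover_closedBall tendsto_natCast_atTop_atTop
  refine le_of_tendsto (hcov.lintegral_tendsto_of_nat
    hF.aestronglyMeasurable.enorm) (Filter.Eventually.of_forall fun n => ?_)
  let σ : ℝ → ℝ := fun y => if 0 ≤ y then 1 else -1
  have hσ : Measurable σ := Measurable.ite measurableSet_Ici measurable_const measurable_const
  have hσ1 : ∀ y, ‖σ y‖ ≤ 1 := by
    intro y
    simp only [σ]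
    split_ifs <;> simp
  have hσy : ∀ y, σ y * y = ‖y‖ := by
    intro y
    simp only [σ, Real.norm_eq_abs]
    split_ifs with hy
    · rw [abs_of_nonneg hy, one_mul]
    · rw [abs_of_neg (not_le.1 hy)]; ring
  set s := Metric.closedBall (0 : E d) (n : ℝ) with hs
  have hsm : MeasurableSet s := Metric.isClosed_closedBall.measurableSet
  have key := enorm_integral_mul_le_of_contDiff_of_le_one (G := s.indicator fun x => σ (F x)) hF
    (((hσ.comp_aemeasurable hF.aemeasurable).aestronglyMeasurable).indicator hsm)
    (fun x => (norm_indicator_le_norm_self _ _).trans (hσ1 _))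
    (HasCompactSupport.intro (isCompact_closedBall 0 (n : ℝ)) fun x hx =>
      Set.indicator_of_notMem hx _) h
  have e : ∀ x, s.indicator (fun x => σ (F x)) x * F x = s.indicator (fun x => ‖F x‖) x := by
    intro x
    by_cases hx : x ∈ s
    · simp [hx, hσy]
    · simp [hx]
  simp_rw [e] at key
  rw [integral_indicator hsm, Real.enorm_eq_ofReal (by positivity),
    ofReal_integral_norm_eq_lintegral_enorm hF.integrableOn] at key
  exact key

theorem enorm_integral_mul_le {p q : ℝ} (hpq : p.HolderConjugate q) {f g : E d → ℝ}
    (hf : AEStronglyMeasurable f volume) (hg : AEStronglyMeasurable g volume) :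
    ‖∫ x, g x * f x‖ₑ ≤
      eLpNorm g (ENNReal.ofReal q) volume * eLpNorm f (ENNReal.ofReal p) volume := by
  have : ENNReal.HolderConjugate (ENNReal.ofReal q) (ENNReal.ofReal p) := hpq.symm.ennrealOfReal
  refine (enorm_integral_le_lintegral_enorm _).trans ?_
  rw [← eLpNorm_one_eq_lintegral_enorm]
  refine (eLpNorm_smul_le_mul_eLpNorm (p := ENNReal.ofReal q) (q := ENNReal.ofReal p) (r := 1)
    hf hg).trans ?_
  exact le_rfl

/-- Since `q < ∞`, smooth compactly supported functions are dense in `L^q`, and Hölder's inequality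
controls the error. -/
theorem enorm_integral_mul_le_of_contDiff_of_memLp {p q : ℝ} (hpq : p.HolderConjugate q)
    {F G : E d → ℝ} (hF : MemLp F (ENNReal.ofReal p) volume)
    (hG : MemLp G (ENNReal.ofReal q) volume) {B : ℝ≥0∞} (hB : B ≠ ∞)
    (h : ∀ g : E d → ℝ, ContDiff ℝ (⊤ : ℕ∞) g → HasCompactSupport g →
      ‖∫ x, g x * F x‖ₑ ≤ B * eLpNorm g (ENNReal.ofReal q) volume) :
    ‖∫ x, G x * F x‖ₑ ≤ B * eLpNorm G (ENNReal.ofReal q) volume := by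
  have hq1 : 1 ≤ ENNReal.ofReal q := ENNReal.one_le_ofReal.2 hpq.symm.lt.le
  have : ENNReal.HolderConjugate (ENNReal.ofReal q) (ENNReal.ofReal p) := hpq.symm.ennrealOfReal
  have hε : ∀ ε : ℝ, 0 < ε → ‖∫ x, G x * F x‖ₑ ≤ B * (eLpNorm G (ENNReal.ofReal q) volume +
      ENNReal.ofReal ε) + ENNReal.ofReal ε * eLpNorm F (ENNReal.ofReal p) volume := by
    intro ε hε
    obtain ⟨g, hgc, hgs, hg⟩ := hG.exist_eLpNorm_sub_le ENNReal.ofReal_ne_top hq1 hε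
    have hgL : MemLp g (ENNReal.ofReal q) volume :=
      hgs.continuous.memLp_of_hasCompactSupport hgc
    have e : ∫ x, G x * F x = (∫ x, g x * F x) + ∫ x, (G - g) x * F x := by
      have i1 : Integrable (fun x => g x * F x) volume := hgL.integrable_mul hF
      have i2 : Integrable (fun x => (G - g) x * F x) volume := (hG.sub hgL).integrable_mul hF
      rw [← integral_add i1 i2]
      congr 1
      ext x
      simp only [Pi.sub_apply]
      ring
    rw [e]
    refine (enorm_add_le _ _).trans (add_le_add ((h g hgs hgc).trans ?_) ?_)
    · gcongr
      have : g = G - (G - g) := by simp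
      calc eLpNorm g (ENNReal.ofReal q) volume
          = eLpNorm (G - (G - g)) (ENNReal.ofReal q) volume := by rw [← this]
        _ ≤ _ := (eLpNorm_sub_le hG.1 (hG.1.sub hgL.1) hq1).trans (by gcongr)
    · refine (enorm_integral_mul_le hpq hF.1 (hG.1.sub hgL.1)).trans ?_
      gcongr
  have ht : Filter.Tendsto (fun n : ℕ => B * (eLpNorm G (ENNReal.ofReal q) volume +
      ENNReal.ofReal (1 / ((n : ℝ) + 1))) + ENNReal.ofReal (1 / ((n : ℝ) + 1)) *
        eLpNorm F (ENNReal.ofReal p) volume) Filter.atTop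
      (nhds (B * (eLpNorm G (ENNReal.ofReal q) volume + 0) +
        0 * eLpNorm F (ENNReal.ofReal p) volume)) := by
    have h0 : Filter.Tendsto (fun n : ℕ => ENNReal.ofReal (1 / ((n : ℝ) + 1))) Filter.atTop
        (nhds 0) := by
      simpa [Function.comp_def] using (ENNReal.continuous_ofReal.tendsto 0).comp
        (tendsto_one_div_add_atTop_nhds_zero_nat (𝕜 := ℝ))
    exact (ENNReal.Tendsto.const_mul (tendsto_const_nhds.add h0) (Or.inr hB)).add
      (ENNReal.Tendsto.mul_const h0 (Or.inr hF.2.ne))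
  simp only [add_zero, zero_mul] at ht
  exact ge_of_tendsto' ht fun n => hε _ (by positivity)

/-- The extremal function `sgn(F) |F|^{p-1}` has `L^q` norm `I^{1/q}` and pairing `I` with `F`,
where `I = ∫ |F|^p`. Hence `I ≤ B I^{1/q}`, and `I < ∞` permits division. -/
theorem eLpNorm_le_of_forall_contDiff {p q : ℝ} (hpq : p.HolderConjugate q)
    {F : E d → ℝ} (hF : MemLp F (ENNReal.ofReal p) volume) {B : ℝ≥0∞} (hB : B ≠ ∞)
    (h : ∀ g : E d → ℝ, ContDiff ℝ (⊤ : ℕ∞) g → HasCompactSupport g →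
      ‖∫ x, g x * F x‖ₑ ≤ B * eLpNorm g (ENNReal.ofReal q) volume) :
    eLpNorm F (ENNReal.ofReal p) volume ≤ B := by
  have hp0 := hpq.pos
  have hq0 := hpq.symm.pos
  let τ : ℝ → ℝ := fun y => if 0 ≤ y then |y| ^ (p - 1) else -|y| ^ (p - 1)
  have hτ : Measurable τ := by
    refine Measurable.ite measurableSet_Ici ?_ ?_ <;> fun_prop
  have hτn : ∀ y, ‖τ y‖ = |y| ^ (p - 1) := by
    intro y
    simp only [τ]
    split_ifs
    · rw [Real.norm_of_nonneg (by positivity)]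
    · rw [norm_neg, Real.norm_of_nonneg (by positivity)]
  have hτy : ∀ y, τ y * y = |y| ^ p := by
    intro y
    rcases eq_or_ne y 0 with rfl | hy
    · simp [hp0.ne']
    have e : |y| ^ p = |y| ^ (p - 1) * |y| := by
      rw [Real.rpow_sub_one (abs_pos.2 hy).ne', div_mul_cancel₀ _ (abs_pos.2 hy).ne']
    simp only [τ, e]
    split_ifs with h0
    · rw [abs_of_nonneg h0]
    · rw [abs_of_neg (not_le.1 h0)]; ring
  have hGe : ∀ x, ‖τ (F x)‖ₑ ^ q = ‖F x‖ₑ ^ p := by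
    intro x
    rw [← ofReal_norm, hτn, ← ofReal_norm (F x), ENNReal.ofReal_rpow_of_nonneg (by positivity) hq0.le,
      ENNReal.ofReal_rpow_of_nonneg (by positivity) hp0.le, ← Real.rpow_mul (abs_nonneg _),
      hpq.sub_one_mul_conj, Real.norm_eq_abs]
  have hGnorm : eLpNorm (fun x => τ (F x)) (ENNReal.ofReal q) volume =
      (∫⁻ x, ‖F x‖ₑ ^ p) ^ (1 / q) := by
    rw [eLpNorm_eq_lintegral_rpow_enorm_toReal (by simpa using hq0) ENNReal.ofReal_ne_top,
      ENNReal.toReal_ofReal hq0.le]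
    simp_rw [hGe]
  have hFnorm : eLpNorm F (ENNReal.ofReal p) volume = (∫⁻ x, ‖F x‖ₑ ^ p) ^ (1 / p) := by
    rw [eLpNorm_eq_lintegral_rpow_enorm_toReal (by simpa using hp0) ENNReal.ofReal_ne_top,
      ENNReal.toReal_ofReal hp0.le]
  set I := ∫⁻ x, ‖F x‖ₑ ^ p with hI
  have hIt : I ≠ ∞ := by
    intro hI'
    have := hF.2
    rw [hFnorm, hI', ENNReal.top_rpow_of_pos (by positivity)] at this
    exact lt_irrefl _ this
  have hG : MemLp (fun x => τ (F x)) (ENNReal.ofReal q) volume := by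
    refine ⟨(hτ.comp_aemeasurable hF.1.aemeasurable).aestronglyMeasurable, ?_⟩
    rw [hGnorm]
    exact ENNReal.rpow_lt_top_of_nonneg (by positivity) hIt
  have key := enorm_integral_mul_le_of_contDiff_of_memLp hpq hF hG hB h
  have hint : ‖∫ x, τ (F x) * F x‖ₑ = I := by
    simp_rw [hτy]
    rw [Real.enorm_eq_ofReal (by positivity), ofReal_integral_eq_lintegral_ofReal]
    · rw [hI]
      congr 1
      ext x
      rw [← ofReal_norm (F x), ENNReal.ofReal_rpow_of_nonneg (by positivity) hp0.le,
        Real.norm_eq_abs]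
    · have : ENNReal.HolderConjugate (ENNReal.ofReal q) (ENNReal.ofReal p) :=
        hpq.symm.ennrealOfReal
      refine (hG.integrable_mul hF).congr (Filter.Eventually.of_forall fun x => hτy _)
    · exact Filter.Eventually.of_forall fun x => by positivity
  rw [hint, hGnorm] at key
  rw [hFnorm]
  rcases eq_or_ne I 0 with h0 | h0
  · rw [h0, ENNReal.zero_rpow_of_pos (by positivity)]
    exact zero_le
  have hq' : I ^ (1 / q) ≠ 0 := by
    simp [ENNReal.rpow_eq_zero_iff, h0, hIt]
  have hq'' : I ^ (1 / q) ≠ ∞ := ENNReal.rpow_ne_top_of_nonneg (by positivity) hIt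
  have hsplit : I ^ (1 / p) * I ^ (1 / q) = I := by
    rw [← ENNReal.rpow_add _ _ h0 hIt]
    have : 1 / p + 1 / q = 1 := by simpa using hpq.inv_add_inv_eq_one
    rw [this, ENNReal.rpow_one]
  rw [← ENNReal.mul_le_mul_iff_left hq' hq'', hsplit]
  exact key

/-- The `L^p` norm of a complex function from a bound on each of the two real functions. -/
theorem eLpNorm_complex_le {F : E d → ℂ} (hF : AEStronglyMeasurable F volume) {p B : ℝ≥0∞}
    (hp : 1 ≤ p) (hre : eLpNorm (fun x => (F x).re) p volume ≤ B)
    (him : eLpNorm (fun x => (F x).im) p volume ≤ B) : eLpNorm F p volume ≤ 2 * B := by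
  calc eLpNorm F p volume ≤ eLpNorm (fun x => ‖(F x).re‖ + ‖(F x).im‖) p volume := by
        refine eLpNorm_mono_real fun x => ?_
        simpa using Complex.norm_le_abs_re_add_abs_im (F x)
    _ ≤ eLpNorm (fun x => ‖(F x).re‖) p volume + eLpNorm (fun x => ‖(F x).im‖) p volume :=
        eLpNorm_add_le (Complex.continuous_re.comp_aestronglyMeasurable hF).norm
          (Complex.continuous_im.comp_aestronglyMeasurable hF).norm hp
    _ ≤ 2 * B := by
        rw [eLpNorm_norm, eLpNorm_norm, two_mul]
        exact add_le_add hre him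

theorem enorm_integral_mul_re_im_le {F : E d → ℂ} {g : E d → ℝ}
    (hi : Integrable fun x => (g x : ℂ) * F x) {B : ℝ≥0∞}
    (h : ‖∫ x, (g x : ℂ) * F x‖ₑ ≤ B) :
    ‖∫ x, g x * (F x).re‖ₑ ≤ B ∧ ‖∫ x, g x * (F x).im‖ₑ ≤ B := by
  have h1 : ∫ x, g x * (F x).re = (∫ x, (g x : ℂ) * F x).re := by
    have := integral_re (𝕜 := ℂ) hi
    simpa using this
  have h2 : ∫ x, g x * (F x).im = (∫ x, (g x : ℂ) * F x).im := by
    have := integral_im (𝕜 := ℂ) hi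
    simpa using this
  rw [h1, h2]
  constructor
  · refine le_trans ?_ h
    rw [← ofReal_norm, ← ofReal_norm]
    exact ENNReal.ofReal_le_ofReal (by simpa using Complex.abs_re_le_norm _)
  · refine le_trans ?_ h
    rw [← ofReal_norm, ← ofReal_norm]
    exact ENNReal.ofReal_le_ofReal (by simpa using Complex.abs_im_le_norm _)

/-! ### Density of compactly supported functions in the Schwartz space -/

theorem Cutoff.hasCompactSupport (χ : Cutoff d) : HasCompactSupport χ.toFun :=
  hasCompactSupport_of_eq_zero χ.eq_zero

/-- The truncation of a Schwartz function to the ball of radius `2(k+1)`. -/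
def Cutoff.truncate (χ : Cutoff d) (u : 𝓢(E d, ℝ)) (k : ℕ) : 𝓢(E d, ℝ) :=
  HasCompactSupport.toSchwartzMap (f := fun x => χ.toFun (((k : ℝ) + 1)⁻¹ • x) * u x)
    (hasCompactSupport_comp_const_smul χ.hasCompactSupport (by positivity)).mul_right
    ((contDiff_comp_const_smul χ.smooth _).mul (u.smooth ⊤))

theorem Cutoff.truncate_apply (χ : Cutoff d) (u : 𝓢(E d, ℝ)) (k : ℕ) (x : E d) :
    χ.truncate u k x = χ.toFun (((k : ℝ) + 1)⁻¹ • x) * u x := rfl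

theorem Cutoff.hasCompactSupport_truncate (χ : Cutoff d) (u : 𝓢(E d, ℝ)) (k : ℕ) :
    HasCompactSupport (χ.truncate u k) :=
  (hasCompactSupport_comp_const_smul χ.hasCompactSupport (by positivity)).mul_right

theorem Cutoff.exists_norm_iteratedFDeriv_le (χ : Cutoff d) (i : ℕ) :
    ∃ B : ℝ, 0 ≤ B ∧ ∀ x, ‖iteratedFDeriv ℝ i (fun x => χ.toFun x - 1) x‖ ≤ B := by
  set η : 𝓢(E d, ℝ) := χ.hasCompactSupport.toSchwartzMap χ.smooth with hη
  -- The summand `1` accounts for the subtracted constant, which contributes only at order `0`.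
  refine ⟨SchwartzMap.seminorm ℝ 0 i η + 1, by positivity, fun x => ?_⟩
  have h1 : iteratedFDeriv ℝ i (fun x => χ.toFun x - 1) x =
      iteratedFDeriv ℝ i χ.toFun x - iteratedFDeriv ℝ i (fun _ => (1 : ℝ)) x := by
    have := iteratedFDeriv_sub_apply (𝕜 := ℝ) (i := i) (f := χ.toFun) (g := fun _ => (1 : ℝ)) (x := x)
      ((χ.smooth.of_le (mod_cast le_top)).contDiffAt) contDiffAt_const
    exact this
  rw [h1]
  refine (norm_sub_le _ _).trans (add_le_add ?_ ?_)
  · exact SchwartzMap.norm_iteratedFDeriv_le_seminorm ℝ η i x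
  · cases i with
    | zero => simp
    | succ i => simp [iteratedFDeriv_succ_const]

/-- The error lives on `‖x‖ ≥ k + 1`, where one extra power of the weight `‖x‖` buys the factor
`1/(k+1)`. The derivatives of the dilated cut-off stay bounded because the dilation factor is at
most `1`. -/
theorem Cutoff.tendsto_truncate (χ : Cutoff d) (u : 𝓢(E d, ℝ)) :
    Filter.Tendsto (χ.truncate u) Filter.atTop (nhds u) := by
  rw [(schwartz_withSeminorms ℝ (E d) ℝ).tendsto_nhds]
  rintro ⟨a, n⟩ ε hε
  choose B hB0 hB using χ.exists_norm_iteratedFDeriv_le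
  set S : ℝ := ∑ i ∈ Finset.range (n + 1),
    (n.choose i : ℝ) * B i * SchwartzMap.seminorm ℝ (a + 1) (n - i) u with hS
  have hS0 : 0 ≤ S := Finset.sum_nonneg fun i _ =>
    mul_nonneg (mul_nonneg (Nat.cast_nonneg _) (hB0 i)) (apply_nonneg _ _)
  have key : ∀ k : ℕ, SchwartzMap.seminorm ℝ a n (χ.truncate u k - u) ≤ S * (1 / ((k : ℝ) + 1)) := by
    intro k
    refine SchwartzMap.seminorm_le_bound ℝ a n _ (by positivity) fun x => ?_
    set c : ℝ := ((k : ℝ) + 1)⁻¹ with hc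
    have hk0 : (0 : ℝ) < (k : ℝ) + 1 := by positivity
    have hc0 : 0 < c := by positivity
    have hc1 : c ≤ 1 := inv_le_one_of_one_le₀ (by simp)
    have hfun : ⇑(χ.truncate u k - u) = fun x => (χ.toFun (c • x) - 1) * u x := by
      ext y
      rw [sub_apply, χ.truncate_apply]
      ring
    rw [hfun]
    by_cases hx : ‖x‖ < k + 1
    · have h0 : (fun x => (χ.toFun (c • x) - 1) * u x) =ᶠ[nhds x] fun _ => 0 := by
        filter_upwards [continuous_norm.continuousAt.eventually (gt_mem_nhds hx)] with y hy
        rw [χ.eq_one (c • y), sub_self, zero_mul]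
        rw [norm_smul, Real.norm_of_nonneg hc0.le, hc, inv_mul_le_iff₀ hk0]
        linarith
      have h1 := h0.iteratedFDeriv (𝕜 := ℝ) n
      rw [h1.eq_of_nhds]
      have : iteratedFDeriv ℝ n (fun _ : E d => (0 : ℝ)) x = 0 := by simp
      rw [this]
      simp only [norm_zero, mul_zero]
      positivity
    · have hxk : (k : ℝ) + 1 ≤ ‖x‖ := not_lt.1 hx
      have hw : ContDiff ℝ (⊤ : ℕ∞) fun x => χ.toFun x - 1 := χ.smooth.sub contDiff_const
      have hD : ∀ i, ‖iteratedFDeriv ℝ i (fun x => χ.toFun (c • x) - 1) x‖ ≤ B i := by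
        intro i
        have := iteratedFDeriv_comp_const_smul (𝕜 := ℝ) (i := i) c
          (hw.of_le (mod_cast le_top))
        rw [this, norm_smul, norm_pow, Real.norm_of_nonneg hc0.le]
        exact (mul_le_of_le_one_left (norm_nonneg _) (pow_le_one₀ hc0.le hc1)).trans (hB i _)
      have hle := norm_iteratedFDeriv_mul_le (𝕜 := ℝ) (n := n) (N := (⊤ : ℕ∞))
        (contDiff_comp_const_smul hw c) (u.smooth ⊤) x (mod_cast le_top)
      calc ‖x‖ ^ a * ‖iteratedFDeriv ℝ n (fun x => (χ.toFun (c • x) - 1) * u x) x‖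
          ≤ ‖x‖ ^ a * ∑ i ∈ Finset.range (n + 1), (n.choose i : ℝ) *
            ‖iteratedFDeriv ℝ i (fun x => χ.toFun (c • x) - 1) x‖ *
              ‖iteratedFDeriv ℝ (n - i) u x‖ := by gcongr
        _ ≤ ∑ i ∈ Finset.range (n + 1), (n.choose i : ℝ) * B i *
            SchwartzMap.seminorm ℝ (a + 1) (n - i) u * (1 / ((k : ℝ) + 1)) := by
            rw [Finset.mul_sum]
            refine Finset.sum_le_sum fun i _ => ?_
            have h1 : ‖x‖ ^ a * ‖iteratedFDeriv ℝ (n - i) u x‖ ≤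
                SchwartzMap.seminorm ℝ (a + 1) (n - i) u * (1 / ((k : ℝ) + 1)) := by
              rw [mul_one_div, le_div_iff₀ hk0]
              refine le_trans ?_ (SchwartzMap.le_seminorm ℝ (a + 1) (n - i) u x)
              calc ‖x‖ ^ a * ‖iteratedFDeriv ℝ (n - i) u x‖ * ((k : ℝ) + 1)
                  ≤ ‖x‖ ^ a * ‖iteratedFDeriv ℝ (n - i) u x‖ * ‖x‖ := by gcongr
                _ = _ := by rw [pow_succ]; ring
            calc _ = (n.choose i : ℝ) * ‖iteratedFDeriv ℝ i (fun x => χ.toFun (c • x) - 1) x‖ *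
                  (‖x‖ ^ a * ‖iteratedFDeriv ℝ (n - i) u x‖) := by ring
              _ ≤ (n.choose i : ℝ) * B i *
                  (SchwartzMap.seminorm ℝ (a + 1) (n - i) u * (1 / ((k : ℝ) + 1))) := by
                  have := hB0 i
                  gcongr
                  exact hD i
              _ = _ := by ring
        _ = S * (1 / ((k : ℝ) + 1)) := by rw [hS, Finset.sum_mul]
  have hlim : Filter.Tendsto (fun k : ℕ => S * (1 / ((k : ℝ) + 1))) Filter.atTop (nhds 0) := by
    simpa using (tendsto_one_div_add_atTop_nhds_zero_nat (𝕜 := ℝ)).const_mul S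
  filter_upwards [hlim.eventually (gt_mem_nhds hε)] with k hk
  exact (key k).trans_lt hk

theorem tendsto_eLpNorm_zero {F : Type*} [NormedAddCommGroup F] [NormedSpace ℝ F]
    {v : ℕ → 𝓢(E d, F)} (hv : Filter.Tendsto v Filter.atTop (nhds 0)) (p : ℝ≥0∞) :
    Filter.Tendsto (fun k => eLpNorm (v k) p volume) Filter.atTop (nhds 0) := by
  obtain ⟨k, C, hC⟩ := SchwartzMap.eLpNorm_le_seminorm ℝ F p (volume : Measure (E d))
  have h0 : Filter.Tendsto (fun j => ((Finset.Iic (k, 0)).sup (schwartzSeminormFamily ℝ (E d) F))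
      (v j)) Filter.atTop (nhds 0) := by
    refine tendsto_order.2 ⟨fun a ha => Filter.Eventually.of_forall fun j =>
      ha.trans_le (apply_nonneg _ _), fun a ha => ?_⟩
    simpa using ((schwartz_withSeminorms ℝ (E d) F).tendsto_nhds' v 0).1 hv (Finset.Iic (k, 0)) a ha
  have h1 : Filter.Tendsto (fun j => (C : ℝ≥0∞) * ENNReal.ofReal
      (((Finset.Iic (k, 0)).sup (schwartzSeminormFamily ℝ (E d) F)) (v j))) Filter.atTop
      (nhds 0) := by
    have h2 := (ENNReal.continuous_ofReal.tendsto _).comp h0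
    rw [ENNReal.ofReal_zero] at h2
    simpa [Function.comp_def] using ENNReal.Tendsto.const_mul h2 (Or.inr (ENNReal.coe_ne_top (r := C)))
  exact tendsto_of_tendsto_of_tendsto_of_le_of_le tendsto_const_nhds h1 (fun _ => zero_le)
    fun j => hC (v j)

/-! ### The norm of `B^α_{r,1}` is continuous on the Schwartz space -/

theorem block_add (χ : Cutoff d) (n : ℕ) (u v : 𝓢(E d, ℝ)) :
    χ.block n (u + v : 𝓢(E d, ℝ)) = χ.block n u + χ.block n v := by
  simp only [χ.block_eq, map_add]
  rfl

theorem aestronglyMeasurable_block (χ : Cutoff d) (n : ℕ) (u : 𝓢(E d, ℝ)) :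
    AEStronglyMeasurable (χ.block n u) volume := by
  rw [χ.block_eq]
  exact (SchwartzMap.continuous _).aestronglyMeasurable

theorem besovNorm_one_add_le (χ : Cutoff d) (α : ℝ) {r : ℝ≥0∞} (hr : 1 ≤ r) (u v : 𝓢(E d, ℝ)) :
    besovNorm χ α r 1 (u + v : 𝓢(E d, ℝ)) ≤ besovNorm χ α r 1 u + besovNorm χ α r 1 v := by
  rw [besovNorm_one, besovNorm_one, besovNorm_one, ← ENNReal.tsum_add]
  refine ENNReal.tsum_le_tsum fun n => ?_
  rw [← mul_add, block_add]
  gcongr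
  exact eLpNorm_add_le (aestronglyMeasurable_block χ n u) (aestronglyMeasurable_block χ n v) hr

theorem tsum_two_rpow_neg_ne_top {σ : ℝ} (hσ : 0 < σ) :
    ∑' n : ℕ, (2 : ℝ≥0∞) ^ (-((n : ℝ) * σ)) ≠ ∞ := by
  have hb : (2 : ℝ≥0∞) ^ (-σ) < 1 :=
    ENNReal.rpow_lt_one_of_one_lt_of_neg (by norm_num) (by linarith)
  have : ∀ n : ℕ, (2 : ℝ≥0∞) ^ (-((n : ℝ) * σ)) = ((2 : ℝ≥0∞) ^ (-σ)) ^ n := by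
    intro n
    rw [← ENNReal.rpow_natCast, ← ENNReal.rpow_mul]
    congr 1
    ring
  simp_rw [this]
  rw [ENNReal.tsum_geometric, ne_eq, ENNReal.inv_eq_top, tsub_eq_zero_iff_le, not_le]
  exact hb

/-- Dividing the profile by `|ξ|^{2N}` and moving `|ξ|^{2N}` onto `u`, as the operator `L`, gains
`2^{-2nN}` on the `n`-th block. This beats the weight `2^{nα}` and gives continuity of the norm in
the Schwartz topology. -/
theorem exists_besovNorm_one_le (χ : Cutoff d) (α : ℝ) {r : ℝ≥0∞} (hr : 1 ≤ r) :
    ∃ (C : ℝ≥0∞) (L : 𝓢(E d, ℂ) →L[ℂ] 𝓢(E d, ℂ)), C ≠ ∞ ∧ ∀ u : 𝓢(E d, ℝ),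
      besovNorm χ α r 1 u ≤ C * (eLpNorm u r volume + eLpNorm (L (ofRealS u)) r volume) := by
  obtain ⟨N, hN⟩ := exists_nat_gt α
  have hpt : (fun ξ : E d => ((‖ξ‖ ^ 2 : ℝ) : ℂ) ^ N).HasTemperateGrowth := by fun_prop
  set P : E d → ℂ := fun ξ => χ.profile ξ * 1 / ((‖ξ‖ ^ 2 : ℝ) : ℂ) ^ N with hP
  have hPs : ContDiff ℝ (⊤ : ℕ∞) P := by
    refine contDiff_div_of_annulus χ.contDiff_profile (fun _ => χ.profile_eq_zero_of_le)
      (fun _ => χ.profile_eq_zero_of_ge) contDiff_const ?_ ?_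
    · exact (contDiff_ofReal_comp (contDiff_norm_sq ℝ)).pow N
    · intro ξ h0 _
      exact pow_ne_zero N (by simpa using h0)
  have hP2 : ∀ ξ, 2 ≤ ‖ξ‖ → P ξ = 0 := fun ξ h => by simp [hP, χ.profile_eq_zero_of_ge h]
  have hPc : HasCompactSupport P := hasCompactSupport_of_eq_zero hP2
  set L : 𝓢(E d, ℂ) →L[ℂ] 𝓢(E d, ℂ) :=
    SchwartzMap.fourierMultiplierCLM ℂ (fun ξ : E d => ((‖ξ‖ ^ 2 : ℝ) : ℂ) ^ N) with hL
  have hblock : ∀ (n : ℕ) (u : 𝓢(E d, ℝ)), eLpNorm (χ.block (n + 1) u) r volume ≤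
      2 ^ (-(((n + 1 : ℕ) : ℝ) * (2 * N))) * ((∫⁻ x, ‖𝓕⁻ P x‖ₑ) * eLpNorm (L (ofRealS u)) r volume) := by
    intro n u
    set c : ℝ := ((2 : ℝ) ^ (n + 1))⁻¹ with hc
    have hc0 : 0 < c := by positivity
    have hPn := contDiff_comp_const_smul hPs c
    have hPnc := hasCompactSupport_comp_const_smul hPc hc0.ne'
    have heq : SchwartzMap.fourierMultiplierCLM ℂ (fun ξ => (χ.symbol (n + 1) ξ : ℂ)) (ofRealS u) =
        (((c ^ 2) ^ N : ℝ) : ℂ) •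
          SchwartzMap.fourierMultiplierCLM ℂ (fun ξ => P (c • ξ)) (L (ofRealS u)) := by
      refine schwartz_ext_fourier fun ξ => ?_
      rw [fourier_fourierMultiplierCLM (hasTemperateGrowth_of_hasCompactSupport
        (χ.contDiff_symbol _) (χ.hasCompactSupport_symbol _)), FourierTransform.fourier_smul,
        smul_apply, fourier_fourierMultiplierCLM
          (hasTemperateGrowth_of_hasCompactSupport hPn hPnc), hL,
        fourier_fourierMultiplierCLM hpt, smul_eq_mul, ← mul_assoc, ← mul_assoc]
      congr 1
      refine (congrFun (χ.symbol_succ n) ξ).trans ?_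
      simp only [← hc, hP]
      rcases eq_or_ne ξ 0 with rfl | hξ
      · have : χ.profile (c • (0 : E d)) = 0 := χ.profile_eq_zero_of_le (by simp)
        rw [this]
        simp
      · have h1 : ((‖ξ‖ ^ 2 : ℝ) : ℂ) ^ N ≠ 0 := pow_ne_zero N (by simpa using hξ)
        have h2 : (((c ^ 2) ^ N : ℝ) : ℂ) ≠ 0 :=
          Complex.ofReal_ne_zero.2 (by positivity)
        have h3 : ((‖c • ξ‖ ^ 2 : ℝ) : ℂ) ^ N = (((c ^ 2) ^ N : ℝ) : ℂ) * ((‖ξ‖ ^ 2 : ℝ) : ℂ) ^ N := by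
          rw [norm_smul, Real.norm_of_nonneg hc0.le, mul_pow]
          push_cast
          rw [mul_pow]
        rw [h3, mul_one]
        field_simp
    rw [χ.block_eq, heq]
    have hcoe : ⇑((((c ^ 2) ^ N : ℝ) : ℂ) •
        SchwartzMap.fourierMultiplierCLM ℂ (fun ξ => P (c • ξ)) (L (ofRealS u))) =
        (((c ^ 2) ^ N : ℝ) : ℂ) •
          ⇑(SchwartzMap.fourierMultiplierCLM ℂ (fun ξ => P (c • ξ)) (L (ofRealS u))) := rfl
    rw [hcoe, eLpNorm_const_smul]
    have hcn : ‖(((c ^ 2) ^ N : ℝ) : ℂ)‖ₑ = 2 ^ (-(((n + 1 : ℕ) : ℝ) * (2 * N))) := by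
      rw [← ofReal_norm, Complex.norm_real, Real.norm_of_nonneg (by positivity), hc, ← pow_mul,
        inv_pow, ← pow_mul, ENNReal.rpow_neg, ENNReal.ofReal_inv_of_pos (by positivity)]
      congr 1
      rw [ENNReal.ofReal_pow (by norm_num), ← ENNReal.rpow_natCast]
      simp
    rw [hcn]
    gcongr
    have := eLpNorm_fourierMultiplierCLM_le hPn hPnc (L (ofRealS u)) hr
    rwa [lintegral_enorm_fourierInv_comp_smul _ hc0] at this
  set G : ℝ≥0∞ := ∑' n : ℕ, (2 : ℝ≥0∞) ^ (-((n : ℝ) * (2 * N - α))) with hG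
  have hGt : G ≠ ∞ := by
    have : (0 : ℝ) ≤ N := Nat.cast_nonneg N
    exact tsum_two_rpow_neg_ne_top (by linarith)
  refine ⟨χ.mass + G * ∫⁻ x, ‖𝓕⁻ P x‖ₑ, L, ENNReal.add_ne_top.2 ⟨χ.mass_lt_top.ne,
    ENNReal.mul_ne_top hGt (lintegral_enorm_fourierInv_lt_top hPs hPc).ne⟩, fun u => ?_⟩
  rw [besovNorm_one, tsum_eq_zero_add' ENNReal.summable]
  calc _ ≤ χ.mass * eLpNorm u r volume +
        ∑' n : ℕ, (2 : ℝ≥0∞) ^ (-(((n + 1 : ℕ) : ℝ) * (2 * N - α))) *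
          ((∫⁻ x, ‖𝓕⁻ P x‖ₑ) * eLpNorm (L (ofRealS u)) r volume) := by
        refine add_le_add ?_ (ENNReal.tsum_le_tsum fun n => ?_)
        · simpa using χ.eLpNorm_block_le 0 u.continuous.aestronglyMeasurable hr
        · refine (mul_le_mul_right (hblock n u) _).trans_eq ?_
          rw [← mul_assoc, ← ENNReal.rpow_add _ _ (by norm_num) (by norm_num)]
          congr 2
          ring
    _ ≤ χ.mass * eLpNorm u r volume +
        G * ((∫⁻ x, ‖𝓕⁻ P x‖ₑ) * eLpNorm (L (ofRealS u)) r volume) := by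
        rw [ENNReal.tsum_mul_right]
        gcongr
        -- The series over `n ≥ 1` is `G` without its first term.
        rw [hG, tsum_eq_zero_add' (f := fun n : ℕ => (2 : ℝ≥0∞) ^ (-((n : ℝ) * (2 * N - α))))
          ENNReal.summable]
        exact le_add_self
    _ ≤ _ := by
        rw [mul_add, add_mul, add_mul]
        refine add_le_add le_self_add ?_
        rw [← mul_assoc]
        exact le_add_self

theorem tendsto_besovNorm_one_zero (χ : Cutoff d) (α : ℝ) {r : ℝ≥0∞} (hr : 1 ≤ r)
    {v : ℕ → 𝓢(E d, ℝ)} (hv : Filter.Tendsto v Filter.atTop (nhds 0)) :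
    Filter.Tendsto (fun k => besovNorm χ α r 1 (v k)) Filter.atTop (nhds 0) := by
  obtain ⟨C, L, hC, h⟩ := exists_besovNorm_one_le χ α hr
  have h1 := tendsto_eLpNorm_zero hv r
  have h2 : Filter.Tendsto (fun k => L (ofRealS (v k))) Filter.atTop (nhds 0) := by
    have := ((L.continuous.comp ofRealS.continuous).tendsto 0).comp hv
    simpa [Function.comp_def] using this
  have h3 := ENNReal.Tendsto.const_mul (h1.add (tendsto_eLpNorm_zero h2 r)) (Or.inr hC)
  rw [add_zero, mul_zero] at h3
  exact tendsto_of_tendsto_of_tendsto_of_le_of_le tendsto_const_nhds h3 (fun _ => zero_le)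
    fun k => h (v k)

/-- The hypothesis is applied to truncations of `u`. The left sides converge by Hölder's inequality.
On the right, the stronger norm of `B^α_{q,1}` satisfies the triangle inequality and tends to zero
on the truncation errors. -/
theorem enorm_integral_schwartzDiff_mul_le (χ : Cutoff d) (m : ℕ) {α : ℝ} {p q : ℝ}
    (hpq : p.HolderConjugate q) {f : E d → ℝ} (hf : MemLp f (ENNReal.ofReal p) volume)
    {h : E d} {B : ℝ≥0∞} (hB : B ≠ ∞)
    (hyp : ∀ φ : E d → ℝ, ContDiff ℝ (⊤ : ℕ∞) φ → HasCompactSupport φ →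
      ‖∫ x, ((fwdDiff h)^[m] φ) x * f x‖ₑ ≤
        B * triebelLizorkinNorm χ α (ENNReal.ofReal q) ∞ φ) (u : 𝓢(E d, ℝ)) :
    ‖∫ x, ((schwartzDiff h)^[m] u) x * f x‖ₑ ≤ B * besovNorm χ α (ENNReal.ofReal q) 1 u := by
  have hq1 : 1 ≤ ENNReal.ofReal q := ENNReal.one_le_ofReal.2 hpq.symm.lt.le
  have : ENNReal.HolderConjugate (ENNReal.ofReal q) (ENNReal.ofReal p) := hpq.symm.ennrealOfReal
  have hint : ∀ w : 𝓢(E d, ℝ), Integrable (fun x => w x * f x) volume := fun w =>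
    (w.memLp (ENNReal.ofReal q)).integrable_mul hf
  set v := χ.truncate u with hv
  have hv0 : Filter.Tendsto (fun k => v k - u) Filter.atTop (nhds 0) := by
    have := (χ.tendsto_truncate u).sub_const u
    rwa [sub_self] at this
  have hd0 : Filter.Tendsto (fun k => (schwartzDiff h)^[m] (v k - u)) Filter.atTop (nhds 0) := by
    have := (((schwartzDiff h : 𝓢(E d, ℝ) →L[ℝ] 𝓢(E d, ℝ)).continuous.iterate m).tendsto 0).comp hv0
    rwa [iterate_map_zero] at this
  have hlim : Filter.Tendsto (fun k => ∫ x, ((schwartzDiff h)^[m] (v k)) x * f x) Filter.atTop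
      (nhds (∫ x, ((schwartzDiff h)^[m] u) x * f x)) := by
    rw [tendsto_iff_edist_tendsto_0]
    have h1 := ENNReal.Tendsto.mul_const (tendsto_eLpNorm_zero hd0 (ENNReal.ofReal q))
      (Or.inr hf.2.ne)
    rw [zero_mul] at h1
    refine tendsto_of_tendsto_of_tendsto_of_le_of_le tendsto_const_nhds h1 (fun _ => zero_le)
      fun k => ?_
    rw [edist_eq_enorm_sub, ← integral_sub (hint _) (hint _)]
    refine le_trans (le_of_eq ?_) (enorm_integral_mul_le hpq hf.1
      (SchwartzMap.continuous _).aestronglyMeasurable)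
    congr 2
    ext x
    rw [iterate_map_sub, sub_apply, sub_mul]
  have hrhs : Filter.Tendsto (fun k => B * (besovNorm χ α (ENNReal.ofReal q) 1 u +
      besovNorm χ α (ENNReal.ofReal q) 1 (v k - u : 𝓢(E d, ℝ)))) Filter.atTop
      (nhds (B * besovNorm χ α (ENNReal.ofReal q) 1 u)) := by
    have := ENNReal.Tendsto.const_mul ((tendsto_const_nhds
      (x := besovNorm χ α (ENNReal.ofReal q) 1 u)).add
      (tendsto_besovNorm_one_zero χ α hq1 hv0)) (Or.inr hB)
    rwa [add_zero] at this
  refine le_of_tendsto_of_tendsto' hlim.enorm hrhs fun k => ?_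
  rw [coe_schwartzDiff_iterate]
  refine (hyp (v k) ((v k).smooth ⊤) (χ.hasCompactSupport_truncate u k)).trans ?_
  gcongr
  refine (triebelLizorkinNorm_top_le χ α hpq.symm.lt.le
    fun n => aestronglyMeasurable_block χ n (v k)).trans ?_
  have e : v k = u + (v k - u) := by abel
  conv_lhs => rw [e]
  exact besovNorm_one_add_le χ α hq1 u (v k - u)

/-! ### The adjoints of the blocks -/

/-- The adjoint of the `n`-th block, whose symbol is the reflection of `φₙ`. -/
def Cutoff.adjointBlock (χ : Cutoff d) (n : ℕ) : 𝓢(E d, ℂ) →L[ℂ] 𝓢(E d, ℂ) :=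
  SchwartzMap.fourierMultiplierCLM ℂ fun ξ => (χ.symbol n (-ξ) : ℂ)

theorem fourierInv_comp_neg (a : E d → ℂ) (x : E d) : 𝓕⁻ (fun ξ => a (-ξ)) x = 𝓕⁻ a (-x) :=
  Real.fourierInv_comp_linearIsometry (LinearIsometryEquiv.neg ℝ) a x

/-- Transposition turns the kernel `k(x - t)` into a convolution with `k(-·)`, whence the reflected
symbol; `χ` need not be even. -/
theorem Cutoff.adjointBlock_apply (χ : Cutoff d) (n : ℕ) (g : 𝓢(E d, ℂ)) (t : E d) :
    χ.adjointBlock n g t = ∫ x, g x * χ.kernel n (x - t) := by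
  rw [adjointBlock, fourierMultiplierCLM_eq_convolution
    (a := fun ξ => (χ.symbol n (-ξ) : ℂ)) ((χ.contDiff_symbol n).comp contDiff_neg)
    ((χ.hasCompactSupport_symbol n).comp_homeomorph (Homeomorph.neg (E d)))]
  congr 1
  ext x
  rw [fourierInv_comp_neg (fun ξ => (χ.symbol n ξ : ℂ)), neg_sub, kernel]

theorem exists_enorm_adjointBlock_le (χ : Cutoff d) (m : ℕ) (s : ℝ) {α : ℝ} (hα : 0 < α)
    {r : ℝ≥0∞} (hr : 1 ≤ r) :
    ∃ C : ℝ≥0∞, C ≠ ∞ ∧ ∀ (T : 𝓢(E d, ℂ) →ₗ[ℂ] ℂ) (K : ℝ), 0 ≤ K →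
      (∀ (u : 𝓢(E d, ℝ)) (h : E d), ‖h‖ ≤ 1 → ‖T (ofRealS ((schwartzDiff h)^[m] u))‖ₑ ≤
        ENNReal.ofReal (K * ‖h‖ ^ s) * besovNorm χ α r 1 u) →
      ∀ (n : ℕ) (g : 𝓢(E d, ℂ)), ‖T (χ.adjointBlock (n + 1) g)‖ₑ ≤
          C * ENNReal.ofReal K * 2 ^ (-(((n + 1 : ℕ) : ℝ) * (s - α))) * eLpNorm g r volume := by
  obtain ⟨C, hC, h⟩ := exists_enorm_fourierMultiplierCLM_le χ m s hα hr
    (θ := fun ξ => χ.profile (-ξ)) (χ.contDiff_profile.comp contDiff_neg)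
    (fun ξ hξ => χ.profile_eq_zero_of_le (by simpa using hξ))
    (fun ξ hξ => χ.profile_eq_zero_of_ge (by simpa using hξ))
  refine ⟨C, hC, fun T K hK hT n g => ?_⟩
  have e : (fun ξ => (χ.symbol (n + 1) (-ξ) : ℂ)) =
      fun ξ => χ.profile (-(((2 : ℝ) ^ (n + 1))⁻¹ • ξ)) := by
    ext ξ
    rw [← smul_neg]
    exact congrFun (χ.symbol_succ n) (-ξ)
  rw [Cutoff.adjointBlock, e]
  exact h T K hK hT (n + 1) g

theorem Cutoff.continuous_kernel (χ : Cutoff d) (n : ℕ) : Continuous (χ.kernel n) :=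
  continuous_fourierInv (χ.contDiff_symbol n) (χ.hasCompactSupport_symbol n)

theorem Cutoff.integrable_kernel (χ : Cutoff d) (n : ℕ) : Integrable (χ.kernel n) :=
  integrable_fourierInv (χ.contDiff_symbol n) (χ.hasCompactSupport_symbol n)

theorem Cutoff.kernel_memLp (χ : Cutoff d) (n : ℕ) (p : ℝ≥0∞) : MemLp (χ.kernel n) p volume := by
  rw [kernel, ← fourierInv_toSchwartzMap (χ.contDiff_symbol n) (χ.hasCompactSupport_symbol n)]
  exact (𝓕⁻ ((χ.hasCompactSupport_symbol n).toSchwartzMap (χ.contDiff_symbol n)) :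
    𝓢(E d, ℂ)).memLp p

theorem Cutoff.aestronglyMeasurable_block (χ : Cutoff d) (n : ℕ) {f : E d → ℝ}
    (hf : AEStronglyMeasurable f volume) : AEStronglyMeasurable (χ.block n f) volume :=
  (hf.convolution_integrand (ContinuousLinearMap.lsmul ℝ ℝ) (μ := volume)
    (χ.continuous_kernel n).aestronglyMeasurable).integral_prod_right'

/-- Fubini. The inner integral of `|f(t) k(x - t)|` is bounded uniformly in `x` by Hölder's
inequality, and `g` is integrable. -/
theorem integral_mul_block_eq (χ : Cutoff d) (n : ℕ) {p q : ℝ} (hpq : p.HolderConjugate q)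
    {f : E d → ℝ} (hf : MemLp f (ENNReal.ofReal p) volume) (g : 𝓢(E d, ℝ)) :
    Integrable (fun x => (g x : ℂ) * χ.block n f x) volume ∧
    ∫ x, (g x : ℂ) * χ.block n f x = ∫ t, (f t : ℂ) * χ.adjointBlock n (ofRealS g) t := by
  have hconj : ENNReal.HolderConjugate (ENNReal.ofReal q) (ENNReal.ofReal p) :=
    hpq.symm.ennrealOfReal
  set k := χ.kernel n with hk
  have hkc : Continuous k := χ.continuous_kernel n
  have hkx : ∀ x, MemLp (fun t => k (x - t)) (ENNReal.ofReal q) volume := fun x =>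
    (χ.kernel_memLp n _).comp_measurePreserving (Measure.measurePreserving_sub_left volume x)
  have hkn : ∀ x, eLpNorm (fun t => k (x - t)) (ENNReal.ofReal q) volume =
      eLpNorm k (ENNReal.ofReal q) volume := fun x =>
    eLpNorm_comp_measurePreserving hkc.aestronglyMeasurable
      (Measure.measurePreserving_sub_left volume x)
  have hfc : AEStronglyMeasurable (fun t => (f t : ℂ)) volume :=
    Complex.continuous_ofReal.comp_aestronglyMeasurable hf.1
  have hm : AEStronglyMeasurable (fun z : E d × E d => (g z.1 : ℂ) * ((f z.2 : ℂ) * k (z.1 - z.2)))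
      (volume.prod volume) := by
    refine AEStronglyMeasurable.mul ?_ (AEStronglyMeasurable.mul hfc.comp_snd ?_)
    · exact (Complex.continuous_ofReal.comp
        (g.continuous.comp continuous_fst)).aestronglyMeasurable
    · exact (hkc.comp (continuous_fst.sub continuous_snd)).aestronglyMeasurable
  have hbound : ∀ x, ∫ t, ‖f t‖ * ‖k (x - t)‖ ≤ (eLpNorm k (ENNReal.ofReal q) volume *
      eLpNorm f (ENNReal.ofReal p) volume).toReal := by
    intro x
    have h1 := enorm_integral_mul_le hpq hf.1.norm (hkx x).1.norm
    rw [eLpNorm_norm, eLpNorm_norm, hkn] at h1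
    have h2 : ∫ t, ‖f t‖ * ‖k (x - t)‖ = ∫ t, ‖k (x - t)‖ * ‖f t‖ := by simp_rw [mul_comm]
    rw [h2]
    refine (le_abs_self _).trans ?_
    rw [← Real.norm_eq_abs, ← toReal_enorm]
    exact ENNReal.toReal_mono (ENNReal.mul_ne_top (χ.kernel_memLp n _).2.ne hf.2.ne) h1
  have hint : Integrable (fun z : E d × E d => (g z.1 : ℂ) * ((f z.2 : ℂ) * k (z.1 - z.2)))
      (volume.prod volume) := by
    rw [integrable_prod_iff hm]
    refine ⟨Filter.Eventually.of_forall fun x => ?_, ?_⟩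
    · have hfL : MemLp (fun t => (f t : ℂ)) (ENNReal.ofReal p) volume := hf.ofReal
      have := (hkx x).integrable_mul hfL
      refine (this.const_mul (g x : ℂ)).congr (Filter.Eventually.of_forall fun t => ?_)
      simp [mul_comm]
    · refine Integrable.mono' ((g.integrable (μ := volume)).norm.mul_const
        (eLpNorm k (ENNReal.ofReal q) volume * eLpNorm f (ENNReal.ofReal p) volume).toReal)
        hm.norm.integral_prod_right' (Filter.Eventually.of_forall fun x => ?_)
      rw [Real.norm_of_nonneg (integral_nonneg fun t => norm_nonneg _)]
      simp only [norm_mul, Complex.norm_real]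
      rw [integral_const_mul]
      gcongr
      exact hbound x
  have e1 : ∀ x, (g x : ℂ) * χ.block n f x =
      ∫ t, (g x : ℂ) * ((f t : ℂ) * k (x - t)) := by
    intro x
    rw [integral_const_mul, Cutoff.block, convolution_def]
    rfl
  constructor
  · refine hint.integral_prod_left.congr (Filter.Eventually.of_forall fun x => (e1 x).symm)
  · simp_rw [e1]
    rw [integral_integral_swap hint]
    congr 1
    ext t
    rw [χ.adjointBlock_apply, ← integral_const_mul]
    congr 1
    ext x
    rw [ofRealS_apply]
    ring

/-! ### The estimate for functions in `L^p` -/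

theorem integrable_ofReal_mul {p : ℝ} (hp : 1 < p) {f : E d → ℝ}
    (hf : MemLp f (ENNReal.ofReal p) volume) (φ : 𝓢(E d, ℂ)) :
    Integrable (fun t => (f t : ℂ) * φ t) volume := by
  have hpq := Real.HolderConjugate.conjExponent hp
  have : ENNReal.HolderConjugate (ENNReal.ofReal p) (ENNReal.ofReal p.conjExponent) :=
    hpq.ennrealOfReal
  exact hf.ofReal.integrable_mul (φ.memLp (ENNReal.ofReal p.conjExponent))

theorem besovNorm_le_of_forall {χ : Cutoff d} {σ : ℝ} {p : ℝ≥0∞} {f : E d → ℝ} {B : ℝ≥0∞}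
    (h : ∀ n : ℕ, eLpNorm (χ.block n f) p volume ≤ B * 2 ^ (-((n : ℝ) * σ))) :
    besovNorm χ σ p ∞ f ≤ B := by
  refine eLpNorm_top_count_le fun n => ?_
  refine (mul_le_mul_right (h n) _).trans_eq ?_
  rw [mul_left_comm, ← ENNReal.rpow_add _ _ (by norm_num) (by norm_num), add_neg_cancel,
    ENNReal.rpow_zero, mul_one]

theorem exists_memBesov_of_memLp (χ : Cutoff d) (m : ℕ) (s : ℝ) {α : ℝ} (hα : 0 < α)
    {p q : ℝ} (hpq : p.HolderConjugate q) :
    ∃ C : ℝ, 0 < C ∧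
      ∀ (f : E d → ℝ) (_ : MemLp f (ENNReal.ofReal p) volume) (K : ℝ) (_ : 0 < K),
        (∀ φ : E d → ℝ, ContDiff ℝ (⊤ : ℕ∞) φ → HasCompactSupport φ →
          ∀ h : E d, ‖h‖ ≤ 1 →
          ENNReal.ofReal |∫ x, ((fwdDiff h)^[m] φ) x * f x| ≤
            ENNReal.ofReal (K * ‖h‖ ^ s) *
              triebelLizorkinNorm χ α (ENNReal.ofReal q) ∞ φ) →
        MemBesov χ (s - α) (ENNReal.ofReal p) ∞ f ∧
        besovNorm χ (s - α) (ENNReal.ofReal p) ∞ f ≤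
          ENNReal.ofReal C * (eLpNorm f (ENNReal.ofReal p) volume + ENNReal.ofReal K) := by
  have hp1 : 1 ≤ ENNReal.ofReal p := ENNReal.one_le_ofReal.2 hpq.lt.le
  have hq1 : 1 ≤ ENNReal.ofReal q := ENNReal.one_le_ofReal.2 hpq.symm.lt.le
  obtain ⟨C, hC, hcore⟩ := exists_enorm_adjointBlock_le χ m s hα hq1
  have hCt : χ.mass + 2 * C ≠ ∞ :=
    ENNReal.add_ne_top.2 ⟨χ.mass_lt_top.ne, ENNReal.mul_ne_top (by norm_num) hC⟩
  -- The mass serves the block `n = 0` and `2 * C` the real and imaginary parts of the others; the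
  -- `1` ensures positivity.
  refine ⟨(χ.mass + 2 * C).toReal + 1, by positivity, fun f hf K hK hyp => ?_⟩
  set T : 𝓢(E d, ℂ) →ₗ[ℂ] ℂ :=
    { toFun := fun φ => ∫ t, (f t : ℂ) * φ t
      map_add' := fun φ ψ => by
        rw [← integral_add (integrable_ofReal_mul hpq.lt hf φ) (integrable_ofReal_mul hpq.lt hf ψ)]
        congr 1
        ext t
        rw [add_apply, mul_add]
      map_smul' := fun c φ => by
        rw [RingHom.id_apply, smul_eq_mul, ← integral_const_mul]
        congr 1
        ext t
        rw [smul_apply, smul_eq_mul]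
        ring } with hT
  have hTapp : ∀ φ, T φ = ∫ t, (f t : ℂ) * φ t := fun _ => rfl
  have hTu : ∀ (u : 𝓢(E d, ℝ)) (h : E d), ‖h‖ ≤ 1 → ‖T (ofRealS ((schwartzDiff h)^[m] u))‖ₑ ≤
      ENNReal.ofReal (K * ‖h‖ ^ s) * besovNorm χ α (ENNReal.ofReal q) 1 u := by
    intro u h hh
    have e : T (ofRealS ((schwartzDiff h)^[m] u)) =
        ((∫ x, ((schwartzDiff h)^[m] u) x * f x : ℝ) : ℂ) := by
      rw [hTapp, ← integral_complex_ofReal]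
      congr 1
      ext x
      rw [ofRealS_apply]
      push_cast
      ring
    rw [e, ← ofReal_norm, Complex.norm_real, ofReal_norm]
    refine enorm_integral_schwartzDiff_mul_le χ m hpq hf ENNReal.ofReal_ne_top
      (fun φ hφ hφc => ?_) u
    rw [← ofReal_norm, Real.norm_eq_abs]
    exact hyp φ hφ hφc h hh
  have hmeas : ∀ n, AEStronglyMeasurable (χ.block n f) volume := fun n =>
    χ.aestronglyMeasurable_block n hf.1
  have hmem : ∀ n, MemLp (χ.block n f) (ENNReal.ofReal p) volume := fun n =>
    ⟨hmeas n, (χ.eLpNorm_block_le n hf.1 hp1).trans_lt (ENNReal.mul_lt_top χ.mass_lt_top hf.2)⟩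
  have hbl : ∀ n : ℕ, eLpNorm (χ.block n f) (ENNReal.ofReal p) volume ≤
      (χ.mass * eLpNorm f (ENNReal.ofReal p) volume + 2 * C * ENNReal.ofReal K) *
        2 ^ (-((n : ℝ) * (s - α))) := by
    intro n
    cases n with
    | zero =>
      simp only [Nat.cast_zero, zero_mul, neg_zero, ENNReal.rpow_zero, mul_one]
      exact (χ.eLpNorm_block_le 0 hf.1 hp1).trans le_self_add
    | succ n =>
      set B := C * ENNReal.ofReal K * 2 ^ (-(((n + 1 : ℕ) : ℝ) * (s - α))) with hB
      have hBt : B ≠ ∞ := ENNReal.mul_ne_top (ENNReal.mul_ne_top hC ENNReal.ofReal_ne_top)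
        (by simp [ENNReal.rpow_eq_top_iff])
      -- Blocks are complex valued in general, so duality is applied to their real and imaginary
      -- parts separately.
      have htest : ∀ g : E d → ℝ, ContDiff ℝ (⊤ : ℕ∞) g → HasCompactSupport g →
          ‖∫ x, g x * (χ.block (n + 1) f x).re‖ₑ ≤ B * eLpNorm g (ENNReal.ofReal q) volume ∧
          ‖∫ x, g x * (χ.block (n + 1) f x).im‖ₑ ≤ B * eLpNorm g (ENNReal.ofReal q) volume := by
        intro g hg hgc
        obtain ⟨hi, he⟩ := integral_mul_block_eq χ (n + 1) hpq hf (hgc.toSchwartzMap hg)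
        refine enorm_integral_mul_re_im_le hi ?_
        refine (congrArg _ he).trans_le ?_
        refine (hcore T K hK.le hTu n _).trans_eq ?_
        congr 1
        exact eLpNorm_congr_norm_ae (Filter.Eventually.of_forall fun x => by
          simp)
      refine (eLpNorm_complex_le (hmeas _) hp1
        (eLpNorm_le_of_forall_contDiff hpq (hmem _).re hBt fun g hg hgc => (htest g hg hgc).1)
        (eLpNorm_le_of_forall_contDiff hpq (hmem _).im hBt
          fun g hg hgc => (htest g hg hgc).2)).trans ?_
      rw [hB, ← mul_assoc, ← mul_assoc]
      gcongr
      exact le_add_self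
  have hfin : besovNorm χ (s - α) (ENNReal.ofReal p) ∞ f ≤
      ENNReal.ofReal ((χ.mass + 2 * C).toReal + 1) *
        (eLpNorm f (ENNReal.ofReal p) volume + ENNReal.ofReal K) := by
    refine (besovNorm_le_of_forall hbl).trans ?_
    have h1 : χ.mass + 2 * C ≤ ENNReal.ofReal ((χ.mass + 2 * C).toReal + 1) := by
      rw [← ENNReal.ofReal_toReal hCt]
      exact ENNReal.ofReal_le_ofReal (by rw [ENNReal.ofReal_toReal hCt]; linarith)
    calc _ ≤ (χ.mass + 2 * C) * (eLpNorm f (ENNReal.ofReal p) volume + ENNReal.ofReal K) := by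
          rw [mul_add, add_mul, add_mul]
          exact add_le_add le_self_add le_add_self
      _ ≤ _ := by gcongr
  exact ⟨⟨hf, hfin.trans_lt (ENNReal.mul_lt_top ENNReal.ofReal_lt_top
    (ENNReal.add_lt_top.2 ⟨hf.2, ENNReal.ofReal_lt_top⟩))⟩, hfin⟩

/-! ### Blocks of finite measures -/

/-- The Littlewood–Paley block `μ ⋆ 𝓕⁻¹ φₙ` of a measure `μ`. -/
def Cutoff.measureBlock (χ : Cutoff d) (μ : Measure (E d)) (n : ℕ) (x : E d) : ℂ :=
  ∫ t, χ.kernel n (x - t) ∂μ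

theorem integrable_comp_sub (μ : Measure (E d)) [IsFiniteMeasure μ] {k : E d → ℂ}
    (hk : Integrable k) :
    Integrable (fun z : E d × E d => k (z.1 - z.2)) (volume.prod μ) := by
  have := Integrable.convolution_integrand (ContinuousLinearMap.lsmul ℝ ℝ) (μ := volume) (ν := μ)
    (integrable_const (1 : ℝ)) hk
  simpa using this

theorem integrable_mul_comp_sub (μ : Measure (E d)) [IsFiniteMeasure μ] {k : E d → ℂ}
    (hk : Integrable k) (g : E d →ᵇ ℝ) :
    Integrable (fun z : E d × E d => (g z.1 : ℂ) * k (z.1 - z.2)) (volume.prod μ) := by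
  refine (integrable_comp_sub μ hk).bdd_mul (c := ‖g‖) ?_ (Filter.Eventually.of_forall fun z => ?_)
  · exact (Complex.continuous_ofReal.comp (g.continuous.comp continuous_fst)).aestronglyMeasurable
  · simpa using g.norm_coe_le_norm z.1

theorem Cutoff.integrable_measureBlock (χ : Cutoff d) (μ : Measure (E d)) [IsFiniteMeasure μ]
    (n : ℕ) : Integrable (χ.measureBlock μ n) :=
  (integrable_comp_sub μ (χ.integrable_kernel n)).integral_prod_left

theorem Cutoff.integrable_mul_measureBlock (χ : Cutoff d) (μ : Measure (E d)) [IsFiniteMeasure μ]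
    (n : ℕ) (g : E d →ᵇ ℝ) : Integrable fun x => (g x : ℂ) * χ.measureBlock μ n x := by
  refine (integrable_mul_comp_sub μ (χ.integrable_kernel n) g).integral_prod_left.congr
    (Filter.Eventually.of_forall fun x => ?_)
  simp only
  rw [integral_const_mul]
  rfl

theorem Cutoff.integral_mul_measureBlock (χ : Cutoff d) (μ : Measure (E d)) [IsFiniteMeasure μ]
    (n : ℕ) (g : E d →ᵇ ℝ) : ∫ x, (g x : ℂ) * χ.measureBlock μ n x =
      ∫ t, ∫ x, (g x : ℂ) * χ.kernel n (x - t) ∂volume ∂μ := by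
  rw [← integral_integral_swap (integrable_mul_comp_sub μ (χ.integrable_kernel n) g)]
  congr 1
  ext x
  exact (integral_const_mul _ _).symm

theorem Cutoff.eLpNorm_measureBlock_le (χ : Cutoff d) (μ : Measure (E d)) [IsProbabilityMeasure μ]
    (n : ℕ) : eLpNorm (χ.measureBlock μ n) 1 volume ≤ χ.mass := by
  rw [eLpNorm_one_eq_lintegral_enorm]
  calc ∫⁻ x, ‖χ.measureBlock μ n x‖ₑ ≤ ∫⁻ x, ∫⁻ t, ‖χ.kernel n (x - t)‖ₑ ∂μ :=
        lintegral_mono fun x => enorm_integral_le_lintegral_enorm _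
    _ = ∫⁻ t, ∫⁻ x, ‖χ.kernel n (x - t)‖ₑ ∂volume ∂μ :=
        lintegral_lintegral_swap (((χ.continuous_kernel n).comp
          (continuous_fst.sub continuous_snd)).measurable.enorm.aemeasurable)
    _ = ∫⁻ _, ∫⁻ x, ‖χ.kernel n x‖ₑ ∂volume ∂μ := by
        congr 1
        ext t
        exact lintegral_sub_right_eq_self (fun x => ‖χ.kernel n x‖ₑ) t
    _ ≤ χ.mass := by
        simpa using χ.lintegral_kernel_le n

/-! ### The kernels form an approximate identity -/

/-- The symbols telescope to `χ(2⁻ᴺξ)`, so the summed kernel is an `L¹`-normalized dilation of the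
zeroth one. -/
theorem Cutoff.sum_kernel (χ : Cutoff d) (N : ℕ) (x : E d) :
    ∑ n ∈ Finset.range (N + 1), χ.kernel n x =
      (((2 : ℝ) ^ N) ^ d : ℝ) • χ.kernel 0 ((2 : ℝ) ^ N • x) := by
  set A : ℕ → 𝓢(E d, ℂ) := fun n =>
    (χ.hasCompactSupport_symbol n).toSchwartzMap (χ.contDiff_symbol n) with hA
  have h1 : ∀ n, χ.kernel n = ⇑(𝓕⁻ (A n) : 𝓢(E d, ℂ)) := fun n =>
    (fourierInv_toSchwartzMap (χ.contDiff_symbol n) (χ.hasCompactSupport_symbol n)).symm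
  have h2 : (𝓕⁻ (∑ n ∈ Finset.range (N + 1), A n) : 𝓢(E d, ℂ)) =
      ∑ n ∈ Finset.range (N + 1), (𝓕⁻ (A n) : 𝓢(E d, ℂ)) :=
    map_sum (FourierTransform.fourierInvCLM ℂ 𝓢(E d, ℂ)) _ _
  have h3 : ⇑(∑ n ∈ Finset.range (N + 1), A n) =
      fun ξ => (χ.symbol 0 (((2 : ℝ) ^ N)⁻¹ • ξ) : ℂ) := by
    ext ξ
    rw [sum_apply, symbol, ← χ.sum_symbol N ξ, Complex.ofReal_sum]
    rfl
  simp_rw [h1]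
  rw [← sum_apply, ← h2, SchwartzMap.fourierInv_coe, h3,
    fourierInv_comp_smul (fun ξ => (χ.symbol 0 ξ : ℂ)) (by positivity), ← h1]
  simp only [inv_pow, inv_inv]
  rfl

theorem Cutoff.integral_kernel_zero (χ : Cutoff d) : ∫ x, χ.kernel 0 x = 1 := by
  set A : 𝓢(E d, ℂ) := (χ.hasCompactSupport_symbol 0).toSchwartzMap (χ.contDiff_symbol 0) with hA
  have h1 : χ.kernel 0 = ⇑(𝓕⁻ A : 𝓢(E d, ℂ)) :=
    (fourierInv_toSchwartzMap (χ.contDiff_symbol 0) (χ.hasCompactSupport_symbol 0)).symm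
  have h2 : 𝓕 (𝓕⁻ A : 𝓢(E d, ℂ)) 0 = A 0 := by rw [FourierTransform.fourier_fourierInv_eq]
  rw [SchwartzMap.fourier_coe, Real.fourier_eq] at h2
  simp only [inner_zero_right, neg_zero, AddChar.map_zero_eq_one, one_smul] at h2
  rw [h1, h2]
  change ((χ.symbol 0 0 : ℝ) : ℂ) = 1
  rw [symbol, χ.eq_one 0 (by simp), Complex.ofReal_one]

theorem Cutoff.sum_integral_mul_kernel (χ : Cutoff d) (N : ℕ) (g : E d →ᵇ ℝ) (t : E d) :
    ∑ n ∈ Finset.range (N + 1), ∫ x, (g x : ℂ) * χ.kernel n (x - t) =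
      ∫ y, (g (((2 : ℝ) ^ N)⁻¹ • y + t) : ℂ) * χ.kernel 0 y := by
  have hi : ∀ n, Integrable fun x => (g x : ℂ) * χ.kernel n (x - t) := fun n =>
    ((χ.integrable_kernel n).comp_sub_right t).bdd_mul (c := ‖g‖)
      (Complex.continuous_ofReal.comp g.continuous).aestronglyMeasurable
      (Filter.Eventually.of_forall fun x => by simpa using g.norm_coe_le_norm x)
  rw [← integral_finsetSum _ fun n _ => hi n]
  simp_rw [← Finset.mul_sum, χ.sum_kernel]
  rw [← integral_add_right_eq_self _ t]
  simp only [add_sub_cancel_right]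
  have := Measure.integral_comp_smul (volume : Measure (E d))
    (fun y => (g (((2 : ℝ) ^ N)⁻¹ • y + t) : ℂ) * χ.kernel 0 y) ((2 : ℝ) ^ N)
  simp only [finrank_euclideanSpace, Fintype.card_fin] at this
  rw [abs_of_pos (by positivity), eq_inv_smul_iff₀ (by positivity), ← integral_smul] at this
  rw [← this]
  congr 1
  ext y
  rw [smul_smul, inv_mul_cancel₀ (by positivity), one_smul]
  simp only [Complex.real_smul]
  ring

/-- The partial sums equal `∫∫ g(2⁻ᴺy + t) k₀(y) dy dμ(t)`. As `k₀` is integrable with integral `1`,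
dominated convergence, in `y` and then in `t`, gives the limit; positivity of `k₀` is not needed. -/
theorem Cutoff.tendsto_sum_integral_mul_measureBlock (χ : Cutoff d) (μ : Measure (E d))
    [IsFiniteMeasure μ] (g : E d →ᵇ ℝ) :
    Filter.Tendsto (fun N => ∑ n ∈ Finset.range (N + 1), ∫ x, (g x : ℂ) * χ.measureBlock μ n x)
      Filter.atTop (nhds (∫ t, (g t : ℂ) ∂μ)) := by
  have hbd : ∀ y, ‖(g y : ℂ)‖ ≤ ‖g‖ := fun y => by simpa using g.norm_coe_le_norm y
  have hgc : Continuous fun y => (g y : ℂ) := Complex.continuous_ofReal.comp g.continuous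
  have hi : ∀ n, Integrable (fun t => ∫ x, (g x : ℂ) * χ.kernel n (x - t)) μ := fun n =>
    (integrable_mul_comp_sub μ (χ.integrable_kernel n) g).integral_prod_right
  simp_rw [χ.integral_mul_measureBlock]
  have e : ∀ N, ∑ n ∈ Finset.range (N + 1), ∫ t, ∫ x, (g x : ℂ) * χ.kernel n (x - t) ∂volume ∂μ =
      ∫ t, ∫ y, (g (((2 : ℝ) ^ N)⁻¹ • y + t) : ℂ) * χ.kernel 0 y ∂volume ∂μ := by
    intro N
    rw [← integral_finsetSum _ fun n _ => hi n]
    simp_rw [χ.sum_integral_mul_kernel]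
  simp_rw [e]
  refine tendsto_integral_of_dominated_convergence (fun _ => ‖g‖ * ∫ y, ‖χ.kernel 0 y‖)
    (fun N => ?_) (integrable_const _) (fun N => Filter.Eventually.of_forall fun t => ?_)
    (Filter.Eventually.of_forall fun t => ?_)
  · simp_rw [← χ.sum_integral_mul_kernel]
    exact (integrable_finsetSum _ fun n _ => hi n).aestronglyMeasurable
  · rw [← integral_const_mul]
    refine norm_integral_le_of_norm_le ((χ.integrable_kernel 0).norm.const_mul _)
      (Filter.Eventually.of_forall fun y => ?_)
    rw [norm_mul]
    gcongr
    exact hbd _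
  · have hlim : (g t : ℂ) = ∫ y, (g t : ℂ) * χ.kernel 0 y := by
      rw [integral_const_mul, χ.integral_kernel_zero, mul_one]
    rw [hlim]
    refine tendsto_integral_of_dominated_convergence (fun y => ‖g‖ * ‖χ.kernel 0 y‖) (fun N => ?_)
      ((χ.integrable_kernel 0).norm.const_mul _)
      (fun N => Filter.Eventually.of_forall fun y => ?_)
      (Filter.Eventually.of_forall fun y => ?_)
    · exact ((hgc.comp (by fun_prop)).mul (χ.continuous_kernel 0)).aestronglyMeasurable
    · rw [norm_mul]
      gcongr
      exact hbd _
    · refine Filter.Tendsto.mul_const _ ?_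
      have h0 : Filter.Tendsto (fun N : ℕ => ((2 : ℝ) ^ N)⁻¹) Filter.atTop (nhds 0) := by
        simpa using tendsto_pow_atTop_nhds_zero_of_lt_one (r := (2 : ℝ)⁻¹) (by norm_num)
          (by norm_num)
      have h1 : Filter.Tendsto (fun N : ℕ => ((2 : ℝ) ^ N)⁻¹ • y + t) Filter.atTop (nhds t) := by
        simpa using (h0.smul_const y).add_const t
      exact (hgc.tendsto t).comp h1

/-! ### Absolute continuity -/

/-- For continuous bounded `g ≥ 0`, the limit of the partial sums gives `∫ g dμ ≤ ∫ g ρ dx` with `ρ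
= ∑ |μₙ|` integrable. Outer approximation extends the inequality to closed sets, and inner
regularity of `μ` does the rest. -/
theorem Cutoff.absolutelyContinuous_of_tsum_ne_top (χ : Cutoff d) (μ : Measure (E d))
    [IsFiniteMeasure μ] (h : ∑' n, eLpNorm (χ.measureBlock μ n) 1 volume ≠ ∞) : μ ≪ volume := by
  set ρ : E d → ℝ≥0∞ := fun x => ∑' n, ‖χ.measureBlock μ n x‖ₑ with hρ
  have hmeas : ∀ n, AEMeasurable (fun x => ‖χ.measureBlock μ n x‖ₑ) volume := fun n =>
    (χ.integrable_measureBlock μ n).aestronglyMeasurable.enorm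
  have hρm : AEMeasurable ρ volume := AEMeasurable.tsum hmeas
  have hρi : ∫⁻ x, ρ x ≠ ∞ := by
    rw [hρ, lintegral_tsum hmeas]
    simpa only [eLpNorm_one_eq_lintegral_enorm] using h
  set ν : Measure (E d) := volume.withDensity ρ with hν
  have : IsFiniteMeasure ν := isFiniteMeasure_withDensity hρi
  have key : ∀ g : E d →ᵇ NNReal, ∫⁻ x, (g x : ℝ≥0∞) ∂μ ≤ ∫⁻ x, (g x : ℝ≥0∞) ∂ν := by
    intro g
    set G : E d →ᵇ ℝ := g.comp (fun a : NNReal => (a : ℝ)) NNReal.isometry_coe.lipschitz with hG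
    have hGx : ∀ x, G x = (g x : ℝ) := fun x => rfl
    have hGe : ∀ x, ‖(G x : ℂ)‖ₑ = (g x : ℝ≥0∞) := by
      intro x
      rw [hGx, ← ofReal_norm, Complex.norm_real, NNReal.norm_eq]
      exact ENNReal.ofReal_coe_nnreal
    have hL : ‖∫ t, (G t : ℂ) ∂μ‖ₑ = ∫⁻ x, (g x : ℝ≥0∞) ∂μ := by
      have h0 : 0 ≤ ∫ t, G t ∂μ := integral_nonneg fun x => NNReal.coe_nonneg (g x)
      rw [integral_complex_ofReal, ← ofReal_norm, Complex.norm_real, Real.norm_of_nonneg h0,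
        ofReal_integral_eq_lintegral_ofReal (G.integrable μ)
          (Filter.Eventually.of_forall fun x => NNReal.coe_nonneg (g x))]
      congr 1
      ext x
      exact ENNReal.ofReal_coe_nnreal
    rw [← hL]
    refine le_of_tendsto (χ.tendsto_sum_integral_mul_measureBlock μ G).enorm
      (Filter.Eventually.of_forall fun N => ?_)
    rw [hν, lintegral_withDensity_eq_lintegral_mul₀ hρm
      (g.continuous.measurable.coe_nnreal_ennreal.aemeasurable)]
    calc ‖∑ n ∈ Finset.range (N + 1), ∫ x, (G x : ℂ) * χ.measureBlock μ n x‖ₑ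
        ≤ ∑ n ∈ Finset.range (N + 1), ∫⁻ x, (g x : ℝ≥0∞) * ‖χ.measureBlock μ n x‖ₑ := by
          refine (enorm_sum_le _ _).trans (Finset.sum_le_sum fun n _ => ?_)
          refine (enorm_integral_le_lintegral_enorm _).trans_eq ?_
          simp_rw [enorm_mul, hGe]
      _ ≤ ∑' n, ∫⁻ x, (g x : ℝ≥0∞) * ‖χ.measureBlock μ n x‖ₑ := ENNReal.sum_le_tsum _
      _ = ∫⁻ x, (ρ * fun x => (g x : ℝ≥0∞)) x := by
          have hm : ∀ n, AEMeasurable (fun x => (g x : ℝ≥0∞) * ‖χ.measureBlock μ n x‖ₑ) volume :=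
            fun n => g.continuous.measurable.coe_nnreal_ennreal.aemeasurable.mul (hmeas n)
          rw [← lintegral_tsum hm]
          congr 1
          ext x
          rw [ENNReal.tsum_mul_left, Pi.mul_apply, mul_comm]
  have hclosed : ∀ F : Set (E d), IsClosed F → μ F ≤ ν F := fun F hF =>
    le_of_tendsto_of_tendsto' (HasOuterApproxClosed.tendsto_lintegral_apprSeq hF μ)
      (HasOuterApproxClosed.tendsto_lintegral_apprSeq hF ν) fun n => key _
  refine Measure.AbsolutelyContinuous.mk fun A hA h0 => ?_
  rw [hA.measure_eq_iSup_isClosed_of_ne_top (measure_ne_top μ A)]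
  simp only [ENNReal.iSup_eq_zero]
  intro F hFA hF
  refine le_antisymm ((hclosed F hF).trans ?_) zero_le
  exact ((withDensity_absolutelyContinuous volume ρ) (measure_mono_null hFA h0)).le

/-! ### Laws of random variables -/

theorem zygmundNorm_neg (χ : Cutoff d) (α : ℝ) (f : E d → ℝ) :
    zygmundNorm χ α (fun x => -f x) = zygmundNorm χ α f := by
  have : ∀ n, χ.block n (fun x => -f x) = -χ.block n f := by
    intro n
    ext x
    simp only [Cutoff.block, convolution_def, Pi.neg_apply, ← integral_neg, map_neg,
      neg_apply]
  simp_rw [zygmundNorm, besovNorm, this, eLpNorm_neg]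

theorem toBoundedContinuousFunction_mem_zygmundSpace (χ : Cutoff d) (α : ℝ) (u : 𝓢(E d, ℝ)) :
    u.toBoundedContinuousFunction ∈ zygmundSpace χ α := by
  intro ε hε
  refine ⟨u, lt_of_le_of_lt ?_ hε⟩
  have : ∀ n, χ.block n (fun x => u.toBoundedContinuousFunction x - u x) = 0 := by
    intro n
    ext x
    simp [Cutoff.block, convolution_def]
  rw [zygmundNorm, besovNorm]
  refine eLpNorm_top_count_le fun n => ?_
  rw [this, eLpNorm_zero, mul_zero]

/-- The hypothesis is one-sided; applying it to `u` and to `-u`, which have equal norms, bounds the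
absolute value. -/
theorem enorm_integral_schwartzDiff_le (χ : Cutoff d) (m : ℕ) {α : ℝ} (μ : Measure (E d))
    {h : E d} {B : ℝ≥0∞}
    (hyp : ∀ φ ∈ zygmundSpace χ α,
      ENNReal.ofReal (∫ x, ((fwdDiff h)^[m] φ) x ∂μ) ≤ B * zygmundNorm χ α φ) (u : 𝓢(E d, ℝ)) :
    ‖∫ x, ((schwartzDiff h)^[m] u) x ∂μ‖ₑ ≤ B * besovNorm χ α ∞ 1 u := by
  have h1 : ∀ v : 𝓢(E d, ℝ), ENNReal.ofReal (∫ x, ((schwartzDiff h)^[m] v) x ∂μ) ≤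
      B * zygmundNorm χ α v := by
    intro v
    rw [coe_schwartzDiff_iterate]
    have hv := hyp _ (toBoundedContinuousFunction_mem_zygmundSpace χ α v)
    have hc : ⇑v.toBoundedContinuousFunction = ⇑v := rfl
    rwa [hc] at hv
  have h2 := h1 (-u)
  have e1 : ∫ x, ((schwartzDiff h)^[m] (-u)) x ∂μ = -∫ x, ((schwartzDiff h)^[m] u) x ∂μ := by
    rw [iterate_map_neg, ← integral_neg]
    rfl
  have e2 : zygmundNorm χ α (-u : 𝓢(E d, ℝ)) = zygmundNorm χ α u := zygmundNorm_neg χ α u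
  rw [e1, e2] at h2
  have h3 : ‖∫ x, ((schwartzDiff h)^[m] u) x ∂μ‖ₑ ≤ B * zygmundNorm χ α u := by
    rw [← ofReal_norm, Real.norm_eq_abs]
    rcases abs_cases (∫ x, ((schwartzDiff h)^[m] u) x ∂μ) with ⟨he, _⟩ | ⟨he, _⟩
    · rw [he]; exact h1 u
    · rw [he]; exact h2
  refine h3.trans ?_
  gcongr
  exact besovNorm_top_le_one χ α ∞ u

/-- The core estimate with `r = ∞`, for the functional `φ ↦ ∫ φ dμ`, combined with `L¹`–`L^∞`
duality. The total mass `1` of `μ` accounts for the `1` in `1 + K` at `n = 0`. -/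
theorem exists_eLpNorm_measureBlock_le (χ : Cutoff d) (m : ℕ) (s : ℝ) {α : ℝ} (hα : 0 < α) :
    ∃ C : ℝ≥0∞, C ≠ ∞ ∧ ∀ (μ : Measure (E d)) [IsProbabilityMeasure μ] (K : ℝ), 0 ≤ K →
      (∀ φ ∈ zygmundSpace χ α, ∀ h : E d, ‖h‖ ≤ 1 →
        ENNReal.ofReal (∫ x, ((fwdDiff h)^[m] φ) x ∂μ) ≤
          ENNReal.ofReal (K * ‖h‖ ^ s) * zygmundNorm χ α φ) →
      ∀ n : ℕ, eLpNorm (χ.measureBlock μ n) 1 volume ≤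
        C * ENNReal.ofReal (1 + K) * 2 ^ (-((n : ℝ) * (s - α))) := by
  obtain ⟨C, hC, hcore⟩ := exists_enorm_adjointBlock_le χ m s hα (r := ∞) le_top
  refine ⟨χ.mass + 2 * C, ENNReal.add_ne_top.2 ⟨χ.mass_lt_top.ne,
    ENNReal.mul_ne_top (by norm_num) hC⟩, fun μ _ K hK hyp n => ?_⟩
  have hint : ∀ φ : 𝓢(E d, ℂ), Integrable φ μ := fun φ =>
    φ.toBoundedContinuousFunction.integrable μ
  set T : 𝓢(E d, ℂ) →ₗ[ℂ] ℂ :=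
    { toFun := fun φ => ∫ t, φ t ∂μ
      map_add' := fun φ ψ => by
        rw [← integral_add (hint φ) (hint ψ)]
        rfl
      map_smul' := fun c φ => by
        rw [RingHom.id_apply, smul_eq_mul, ← integral_const_mul]
        rfl } with hT
  have hTapp : ∀ φ, T φ = ∫ t, φ t ∂μ := fun _ => rfl
  have hTu : ∀ (u : 𝓢(E d, ℝ)) (h : E d), ‖h‖ ≤ 1 → ‖T (ofRealS ((schwartzDiff h)^[m] u))‖ₑ ≤
      ENNReal.ofReal (K * ‖h‖ ^ s) * besovNorm χ α ∞ 1 u := by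
    intro u h hh
    have e : T (ofRealS ((schwartzDiff h)^[m] u)) =
        ((∫ x, ((schwartzDiff h)^[m] u) x ∂μ : ℝ) : ℂ) := by
      rw [hTapp, ← integral_complex_ofReal]
      rfl
    rw [e, ← ofReal_norm, Complex.norm_real, ofReal_norm]
    exact enorm_integral_schwartzDiff_le χ m μ (fun φ hφ => hyp φ hφ h hh) u
  have hK1 : 1 ≤ ENNReal.ofReal (1 + K) := ENNReal.one_le_ofReal.2 (by linarith)
  have hK2 : ENNReal.ofReal K ≤ ENNReal.ofReal (1 + K) := ENNReal.ofReal_le_ofReal (by linarith)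
  cases n with
  | zero =>
    simp only [Nat.cast_zero, zero_mul, neg_zero, ENNReal.rpow_zero, mul_one]
    calc _ ≤ χ.mass := χ.eLpNorm_measureBlock_le μ 0
      _ ≤ (χ.mass + 2 * C) * 1 := by rw [mul_one]; exact le_self_add
      _ ≤ _ := by gcongr
  | succ n =>
    set B := C * ENNReal.ofReal K * 2 ^ (-(((n + 1 : ℕ) : ℝ) * (s - α))) with hB
    have hFi := χ.integrable_measureBlock μ (n + 1)
    have htest : ∀ g : E d → ℝ, ContDiff ℝ (⊤ : ℕ∞) g → HasCompactSupport g →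
        ‖∫ x, g x * (χ.measureBlock μ (n + 1) x).re‖ₑ ≤ B * eLpNorm g ∞ volume ∧
        ‖∫ x, g x * (χ.measureBlock μ (n + 1) x).im‖ₑ ≤ B * eLpNorm g ∞ volume := by
      intro g hg hgc
      set G : 𝓢(E d, ℝ) := hgc.toSchwartzMap hg with hG
      refine enorm_integral_mul_re_im_le
        (χ.integrable_mul_measureBlock μ (n + 1) G.toBoundedContinuousFunction) ?_
      have he := χ.integral_mul_measureBlock μ (n + 1) G.toBoundedContinuousFunction
      have he2 : ∫ t, ∫ x, (G.toBoundedContinuousFunction x : ℂ) * χ.kernel (n + 1) (x - t) ∂volume ∂μ =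
          T (χ.adjointBlock (n + 1) (ofRealS G)) := by
        rw [hTapp]
        simp_rw [χ.adjointBlock_apply]
        rfl
      refine (congrArg _ (he.trans he2)).trans_le ?_
      refine (hcore T K hK hTu n _).trans_eq ?_
      congr 1
      exact eLpNorm_congr_norm_ae (Filter.Eventually.of_forall fun x => by simp [hG])
    refine (eLpNorm_complex_le hFi.aestronglyMeasurable le_rfl
      (eLpNorm_one_le_of_forall_contDiff hFi.re fun g hg hgc => (htest g hg hgc).1)
      (eLpNorm_one_le_of_forall_contDiff hFi.im fun g hg hgc => (htest g hg hgc).2)).trans ?_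
    rw [hB, ← mul_assoc, ← mul_assoc]
    gcongr
    exact le_add_self

theorem continuous_fwdDiff_iterate {φ : E d → ℝ} (hφ : Continuous φ) (h : E d) (m : ℕ) :
    Continuous ((fwdDiff h)^[m] φ) := by
  induction m with
  | zero => exact hφ
  | succ m ih =>
    rw [Function.iterate_succ_apply']
    exact (ih.comp (continuous_id.add continuous_const)).sub ih

theorem exists_hasPDF_memBesov (χ : Cutoff d) (m : ℕ) {s α : ℝ} (hα : 0 < α) (hαs : α < s) :
    ∃ C : ℝ, 0 < C ∧
      ∀ (Ω : Type*) [MeasurableSpace Ω] (P : Measure Ω) [IsProbabilityMeasure P]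
        (X : Ω → E d) (_ : AEMeasurable X P) (K : ℝ) (_ : 0 < K),
        (∀ φ ∈ zygmundSpace χ α, ∀ h : E d, ‖h‖ ≤ 1 →
          ENNReal.ofReal (∫ ω, ((fwdDiff h)^[m] φ) (X ω) ∂P) ≤
            ENNReal.ofReal (K * ‖h‖ ^ s) * zygmundNorm χ α φ) →
        HasPDF X P volume ∧
        MemBesov χ (s - α) 1 ∞ (fun x => (pdf X P volume x).toReal) ∧
        besovNorm χ (s - α) 1 ∞ (fun x => (pdf X P volume x).toReal) ≤
          ENNReal.ofReal (C * (1 + K)) := by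
  obtain ⟨C, hC, hcore⟩ := exists_eLpNorm_measureBlock_le χ m s hα
  refine ⟨C.toReal + 1, by positivity, fun Ω _ P _ X hX K hK hyp => ?_⟩
  set μ := P.map X with hμ
  have : IsProbabilityMeasure μ := Measure.isProbabilityMeasure_map hX
  have hbl := hcore μ K hK.le fun φ hφ h hh => by
    rw [hμ, integral_map hX (continuous_fwdDiff_iterate φ.continuous h m).aestronglyMeasurable]
    exact hyp φ hφ h hh
  -- The block bounds form a convergent geometric series because `α < s`.
  have hac : μ ≪ volume := by
    refine χ.absolutelyContinuous_of_tsum_ne_top μ ?_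
    refine ne_top_of_le_ne_top ?_ (ENNReal.tsum_le_tsum hbl)
    rw [ENNReal.tsum_mul_left]
    exact ENNReal.mul_ne_top (ENNReal.mul_ne_top hC ENNReal.ofReal_ne_top)
      (tsum_two_rpow_neg_ne_top (sub_pos.2 hαs))
  have hpdf : HasPDF X P volume :=
    (hasPDF_iff_of_aemeasurable hX).2 ⟨inferInstance, hac⟩
  -- Once the density exists, integrating the kernel against it is integrating against the law, so
  -- the bounds already proved for `μ` carry over.
  have hblock : ∀ n, χ.block n (fun x => (pdf X P volume x).toReal) = χ.measureBlock μ n := by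
    intro n
    ext x
    have hk : Continuous fun t => χ.kernel n (x - t) :=
      (χ.continuous_kernel n).comp (continuous_const.sub continuous_id)
    have he : ∫ t, (pdf X P volume t).toReal • χ.kernel n (x - t) =
        ∫ ω, χ.kernel n (x - X ω) ∂P := pdf.integral_pdf_smul hk.aestronglyMeasurable
    rw [Cutoff.block, convolution_def, Cutoff.measureBlock, hμ,
      integral_map hX hk.aestronglyMeasurable, ← he]
    rfl
  have hle : besovNorm χ (s - α) 1 ∞ (fun x => (pdf X P volume x).toReal) ≤
      ENNReal.ofReal ((C.toReal + 1) * (1 + K)) := by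
    refine (besovNorm_le_of_forall (B := C * ENNReal.ofReal (1 + K)) fun n => ?_).trans ?_
    · rw [hblock]
      exact hbl n
    · rw [ENNReal.ofReal_mul (by positivity)]
      gcongr
      calc C = ENNReal.ofReal C.toReal := (ENNReal.ofReal_toReal hC).symm
        _ ≤ _ := ENNReal.ofReal_le_ofReal (by linarith)
  have hmem : MemLp (fun x => (pdf X P volume x).toReal) 1 volume := by
    rw [memLp_one_iff_integrable]
    refine integrable_toReal_of_lintegral_ne_top (measurable_pdf X P volume).aemeasurable ?_
    rw [pdf.lintegral_eq_measure_univ]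
    exact measure_ne_top P _
  exact ⟨hpdf, ⟨hmem, hle.trans_lt ENNReal.ofReal_lt_top⟩, hle⟩

end Smoothing

end

theorem lemmal (d m : ℕ) (s α : ℝ) (hα : 0 < α) (hαs : α < s) (hsm : s < m)
    (χ : Smoothing.Cutoff d) :
    -- laws of random variables
    (∃ C : ℝ, 0 < C ∧
      ∀ (Ω : Type*) [MeasurableSpace Ω] (P : Measure Ω) [IsProbabilityMeasure P]
        (X : Ω → Smoothing.E d) (_ : AEMeasurable X P) (K : ℝ) (_ : 0 < K),
        (∀ φ ∈ Smoothing.zygmundSpace χ α, ∀ h : Smoothing.E d, ‖h‖ ≤ 1 →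
          ENNReal.ofReal (∫ ω, ((fwdDiff h)^[m] φ) (X ω) ∂P) ≤
            ENNReal.ofReal (K * ‖h‖ ^ s) * Smoothing.zygmundNorm χ α φ) →
        HasPDF X P volume ∧
        Smoothing.MemBesov χ (s - α) 1 ∞ (fun x => (pdf X P volume x).toReal) ∧
        Smoothing.besovNorm χ (s - α) 1 ∞ (fun x => (pdf X P volume x).toReal) ≤
          ENNReal.ofReal (C * (1 + K))) ∧
    -- functions in `L^p`, `1 < p < ∞`
    (∀ p q : ℝ, p.HolderConjugate q →
      ∃ C : ℝ, 0 < C ∧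
        ∀ (f : Smoothing.E d → ℝ) (_ : MemLp f (ENNReal.ofReal p) volume) (K : ℝ) (_ : 0 < K),
          (∀ φ : Smoothing.E d → ℝ, ContDiff ℝ (⊤ : ℕ∞) φ → HasCompactSupport φ →
            ∀ h : Smoothing.E d, ‖h‖ ≤ 1 →
            ENNReal.ofReal |∫ x, ((fwdDiff h)^[m] φ) x * f x| ≤
              ENNReal.ofReal (K * ‖h‖ ^ s) *
                Smoothing.triebelLizorkinNorm χ α (ENNReal.ofReal q) ∞ φ) →
          Smoothing.MemBesov χ (s - α) (ENNReal.ofReal p) ∞ f ∧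
          Smoothing.besovNorm χ (s - α) (ENNReal.ofReal p) ∞ f ≤
            ENNReal.ofReal C *
              (eLpNorm f (ENNReal.ofReal p) volume + ENNReal.ofReal K)) := by
  exact ⟨Smoothing.exists_hasPDF_memBesov χ m hα hαs,
    fun p q hpq => Smoothing.exists_memBesov_of_memLp χ m s hα hpq⟩
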